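/- Consider an asynchronous message-passing system of $n$ processes on a complete communication graph with reliable channels (each message between correct processes is eventually delivered, with unbounded delay, and the receiver of a message knows who sent it). A set of at most $f$ processes is Byzantine: these deviate arbitrarily from the algorithm and collude. The system is authenticated: each process can sign messages, everybody can verify who signed a message, and no process can create a signature of another one; in particular Byzantine processes cannot forge signatures of correct processes, but they may use every signature that a correct process has issued before. The other (correct) processes run a deterministic event-driven algorithm. In the Byzantine lattice agreement problem each process $i$ has an input $x_i$ in a join semilattice $(X,\le,\sqcup)$. Let $C$ be the set of correct processes and $t \le f$ the number of Byzantine processes. Each correct process $i$ has to decide, eventually and irrevocably, an output $y_i\in X$ such that: - Comparability: for all $i,j\in C$, $y_i\le y_j$ or $y_j\le y_i$. - Downward-Validity: $x_i\le y_i$ for all $i\in C$. - Upward-Validity: there is a set $B\subseteq X$ with $|B|\le t$ and $\bigsqcup\{y_i : i\in C\}\le\bigsqcup(\{x_i : i\in C\}\cup B)$. Theorem. There is an absolute constant $c$ such that, for all $n$ and $f$ with $f<n/3$ and every join semilattice $X$, there is an algorithm that solves the Byzantine lattice agreement problem with inputs in $X$ in every execution of the authenticated asynchronous system with $n$ processes,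 at most $f$ of which are Byzantine. It takes $O(\log f)$ asynchronous rounds: if local computation takes no time and each message between correct processes takes at most one unit of time, every correct process has decided by time $c\,(1+\log_2 f)$. It takes $O(n^2\log f)$ messages: in each execution the correct processes send at most $c\,n^2(1+\log_2 f)$ messages in total. (For $f\le 1$ read $\log_2 f$ as $0$.) -/

import Mathlib

/-! # Asynchronous message passing with Byzantine failures and digital signatures

The system has `n` processes, with ids in `Fin n`, on a complete communication graph.
Signatures are idealised: a signed message is a term that names its signer, so everybody can
verify who signed it, and the only restriction is on who can create such a term. -/

namespace AuthBLA

universe u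

/-- Messages over a type `D` of plain data: plain data, pairs, and `sign i m`, which is the
message `m` together with the signature of process `i` on it. Signatures can be nested. -/
inductive Msg (n : ℕ) (D : Type u) : Type u
  | data (d : D) : Msg n D
  | pair (a b : Msg n D) : Msg n D
  | sign (i : Fin n) (m : Msg n D) : Msg n D

/-- All the signatures that occur in a message: `(i, p) ∈ m.sigs` means that `m` contains the
signature of `i` on `p`. -/
def Msg.sigs {n : ℕ} {D : Type u} : Msg n D → Set (Fin n × Msg n D)
  | .data _ => ∅
  | .pair a b => a.sigs ∪ b.sigs
  | .sign i m => insert (i, m) m.sigs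

/-- A deterministic, event-driven algorithm for `n` processes whose inputs and outputs are
in `X`. Process `i` with input `x` starts in the state `(start i x).1` and sends the messages
`(start i x).2`, a list of pairs (destination, message). When process `i` in state `s` receives
`m` from process `j`, it moves to the state `(step i s j m).1` and sends the messages
`(step i s j m).2`. `output s` is the value decided in state `s`, if there is one. -/
structure Protocol (n : ℕ) (X : Type u) where
  /-- local states -/
  State : Type u
  /-- plain data in messages -/
  Data : Type u
  /-- initial state and initial messages -/
  start : Fin n → X → State × List (Fin n × Msg n Data)
  /-- reaction to a message from a given sender -/
  step : Fin n → State → Fin n → Msg n Data → State × List (Fin n × Msg n Data)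
  /-- decided value -/
  output : State → Option X

namespace Protocol

variable {n : ℕ} {X : Type u}

/-- The state of process `i` with input `x` after receiving, in this order, the messages in
`h` (pairs of sender and message). -/
def localState (P : Protocol n X) (i : Fin n) (x : X) (h : List (Fin n × Msg n P.Data)) :
    P.State :=
  h.foldl (fun s e => (P.step i s e.1 e.2).1) (P.start i x).1

/-- A process running the protocol can create its own signatures only: each signature of
another process in a message that it sends occurs in a message that it has received. -/
structure SignsHonestly (P : Protocol n X) : Prop where
  start : ∀ (i : Fin n) (x : X), ∀ o ∈ (P.start i x).2, ∀ s ∈ o.2.sigs, s.1 = i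
  step : ∀ (i : Fin n) (x : X) (h : List (Fin n × Msg n P.Data)) (j : Fin n)
    (m : Msg n P.Data), ∀ o ∈ (P.step i (P.localState i x h) j m).2, ∀ s ∈ o.2.sigs,
    s.1 = i ∨ s ∈ m.sigs ∨ ∃ e ∈ h, s ∈ e.2.sigs

end Protocol

/-- A message with its sender and its destination. -/
structure Envelope (n : ℕ) (D : Type u) where
  src : Fin n
  dst : Fin n
  msg : Msg n D

/-- A global configuration: the local states, the list of all messages sent so far by correct
processes (a message is identified by its position in this list), and the set of those that
have been delivered. The local states of Byzantine processes are never used. -/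
structure Config {n : ℕ} {X : Type u} (P : Protocol n X) where
  state : Fin n → P.State
  sent : List (Envelope n P.Data)
  delivered : Set ℕ

section Executions

variable {n : ℕ} {X : Type u}

/-- Put the sender on a list of outgoing messages. -/
def envelopes {D : Type u} (i : Fin n) (l : List (Fin n × Msg n D)) : List (Envelope n D) :=
  l.map fun o => ⟨i, o.1, o.2⟩

/-- The initial configuration when the Byzantine processes are those in `F` and the inputs
are `x`: each correct process has sent its initial messages. -/
def Config.initial (P : Protocol n X) (F : Finset (Fin n)) (x : Fin n → X) : Config P where
  state i := (P.start i (x i)).1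
  sent := ((List.finRange n).filter (fun i => i ∉ F)).flatMap
    fun i => envelopes i (P.start i (x i)).2
  delivered := ∅

/-- Process `i` receives `m` from process `j` and reacts to it. -/
def Config.receive {P : Protocol n X} (c : Config P) (i j : Fin n) (m : Msg n P.Data) :
    Config P where
  state := Function.update c.state i (P.step i (c.state i) j m).1
  sent := c.sent ++ envelopes i (P.step i (c.state i) j m).2
  delivered := c.delivered

/-- The possible events when the Byzantine processes are those in `F`.

* `idle`: nothing happens.
* `deliver`: some message of a correct process that was not delivered before is delivered to
  its destination, a correct process.
* `byzantine`: a correct process `i` receives from a Byzantine process `j` an arbitrary message,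
  subject to unforgeability only: a signature of a correct process in it must have been
  issued by this process before. (No secrecy is assumed: Byzantine processes collude
  and may use all that was ever sent.) -/
inductive Step {P : Protocol n X} (F : Finset (Fin n)) : Config P → Config P → Prop
  | idle (c : Config P) : Step F c c
  | deliver (c : Config P) (id : ℕ) (e : Envelope n P.Data) (sent : c.sent[id]? = some e)
      (pending : id ∉ c.delivered) (correct : e.dst ∉ F) :
      Step F c { c.receive e.dst e.src e.msg with delivered := insert id c.delivered }
  | byzantine (c : Config P) (i j : Fin n) (m : Msg n P.Data) (correct : i ∉ F) (faulty : j ∈ F)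
      (unforgeable : ∀ s ∈ m.sigs, s.1 ∉ F → ∃ e ∈ c.sent, e.src = s.1 ∧ s ∈ e.msg.sigs) :
      Step F c (c.receive i j m)

/-- An execution of `P` with set `F` of Byzantine processes and inputs `x`: an infinite
sequence of configurations. Message delays are unbounded, but channels are reliable: each
message between correct processes is eventually delivered (exactly once, by `Step`). -/
structure Execution (P : Protocol n X) (F : Finset (Fin n)) (x : Fin n → X) where
  conf : ℕ → Config P
  conf_zero : conf 0 = Config.initial P F x
  step : ∀ k, Step F (conf k) (conf (k + 1))
  reliable : ∀ k id e, (conf k).sent[id]? = some e → e.dst ∉ F → ∃ k', id ∈ (conf k').delivered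

namespace Execution

variable {P : Protocol n X} {F : Finset (Fin n)} {x : Fin n → X}

/-- The output of process `i` in the `k`-th configuration. -/
def out (E : Execution P F x) (k : ℕ) (i : Fin n) : Option X :=
  P.output ((E.conf k).state i)

/-- Process `i` outputs `y`, and this is final. -/
structure Decides (E : Execution P F x) (i : Fin n) (y : X) : Prop where
  eventually : ∃ k, E.out k i = some y
  unique : ∀ k z, E.out k i = some z → z = y
  final : ∀ k k', k ≤ k' → E.out k i = some y → E.out k' i = some y

/-- `τ k` is a possible time at which the `k`-th configuration is reached, measured in
asynchronous rounds: the execution starts at time `0`, local computation takes no time, and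
each message between correct processes takes at most one unit of time (while a message sent
by time `τ k` is pending, the next event happens no later than `τ k + 1`). -/
structure IsRoundTiming (E : Execution P F x) (τ : ℕ → ℝ) : Prop where
  zero : τ 0 = 0
  mono : Monotone τ
  delay : ∀ k id e, (E.conf k).sent[id]? = some e → e.dst ∉ F →
    ∀ k', id ∉ (E.conf k').delivered → τ (k' + 1) ≤ τ k + 1

end Execution

end Executions

/-- Byzantine lattice agreement, for the set `F` of Byzantine processes, the inputs `x` and the
outputs `y` (only those of correct processes matter). -/
structure IsBLA {n : ℕ} {X : Type u} [SemilatticeSup X] (F : Finset (Fin n)) (x y : Fin n → X) :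
    Prop where
  comparability : ∀ i ∉ F, ∀ j ∉ F, y i ≤ y j ∨ y j ≤ y i
  downward_validity : ∀ i ∉ F, x i ≤ y i
  upward_validity : ∃ B : Finset X, B.card ≤ F.card ∧ ∃ u v : X,
    IsLUB {a | ∃ i ∉ F, y i = a} u ∧ IsLUB ({a | ∃ i ∉ F, x i = a} ∪ (B : Set X)) v ∧ u ≤ v

/-- `P` is an algorithm for Byzantine lattice agreement in authenticated asynchronous systems
that tolerates `f` Byzantine processes, in at most `T` asynchronous rounds, with at most `M`
messages sent by correct processes in total. -/
structure Solves {n : ℕ} {X : Type u} [SemilatticeSup X] (P : Protocol n X) (f T M : ℕ) :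
    Prop where
  signsHonestly : P.SignsHonestly
  agreement : ∀ (F : Finset (Fin n)), F.card ≤ f → ∀ (x : Fin n → X) (E : Execution P F x),
    ∃ y : Fin n → X, (∀ i ∉ F, E.Decides i (y i)) ∧ IsBLA F x y
  rounds : ∀ (F : Finset (Fin n)), F.card ≤ f → ∀ (x : Fin n → X) (E : Execution P F x)
    (τ : ℕ → ℝ), E.IsRoundTiming τ → ∀ i ∉ F, ∃ k, τ k ≤ T ∧ (E.out k i).isSome
  messages : ∀ (F : Finset (Fin n)), F.card ≤ f → ∀ (x : Fin n → X) (E : Execution P F x) (k : ℕ),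
    (E.conf k).sent.length ≤ M

end AuthBLA

/-! A certificate, signed by `n - f` processes, binds each process to one input, so that a value,
which is a set of certified inputs, has at most `n` elements. Every process starts with at least
`n - f` of them, so the sizes of the values lie in an interval of `f + 1` numbers.

The processes walk down a binary tree of groups. In a group, a process writes its value to a quorum
and then reads the values that a quorum has accepted there. If the union `U` of what it has read
has at least the middle size, it writes and reads `U` and goes to the upper subgroup with the
result; otherwise it goes to the lower subgroup with the value that it has written. Of two
processes, the one whose write is completed later reads the value of the other, since two quorums
share a correct process. This has three consequences: the values of a lower subgroup are contained
in those of the upper one, the values of an upper subgroup are at least of middle size, and all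
those of a lower one are contained in the read result of the process that wrote last, which is
below middle size. So each level halves the interval of sizes, and in a leaf all values are equal:
the values in the leaves form a chain, and every process decides the join of its value.

As values and their origin are proved by signatures, a Byzantine process can only take part in the
protocol or remain silent, and it contributes at most one input to the certified ones. On each of
the `log f + O(1)` levels, a process asks at most four queries and answers at most four queries of
each process. -/

namespace AuthBLA

universe u

variable {n : ℕ} {X : Type u}

theorem Msg.finite_sigs {D : Type u} (m : Msg n D) : m.sigs.Finite := by
  induction m with
  | data => exact Set.finite_empty
  | pair a b iha ihb => exact iha.union ihb
  | sign i m ih => exact ih.insert _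

theorem mem_envelopes {D : Type u} {i : Fin n} {l : List (Fin n × Msg n D)} {e : Envelope n D} :
    e ∈ envelopes i l ↔ e.src = i ∧ (e.dst, e.msg) ∈ l := by
  constructor
  · intro he
    obtain ⟨o, ho, rfl⟩ := List.mem_map.1 he
    exact ⟨rfl, ho⟩
  · rintro ⟨rfl, he⟩
    exact List.mem_map.2 ⟨_, he, rfl⟩

theorem length_envelopes {D : Type u} (i : Fin n) (l : List (Fin n × Msg n D)) :
    (envelopes i l).length = l.length :=
  List.length_map _

theorem getElem?_of_prefix {α : Type*} {l l' : List α} (h : l <+: l') {k : ℕ} {a : α}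
    (ha : l[k]? = some a) : l'[k]? = some a := by
  obtain ⟨hk, rfl⟩ := List.getElem?_eq_some_iff.1 ha
  exact List.prefix_iff_getElem?.1 h k hk

section Steps

variable {P : Protocol n X} {F : Finset (Fin n)} {c c' : Config P}

/-- Process `i` is correct, receives `m` from `j`, and thereby `c` becomes `c'`. The event may be
a delivery or an injection by a Byzantine process: `origin` keeps what both have in common. -/
structure Receives (F : Finset (Fin n)) (c c' : Config P) (i j : Fin n) (m : Msg n P.Data) :
    Prop where
  correct : i ∉ F
  state_self : c'.state i = (P.step i (c.state i) j m).1
  state_of_ne : ∀ s ≠ i, c'.state s = c.state s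
  sent : c'.sent = c.sent ++ envelopes i (P.step i (c.state i) j m).2
  origin : ⟨j, i, m⟩ ∈ c.sent ∨
    j ∈ F ∧ ∀ s ∈ m.sigs, s.1 ∉ F → ∃ e ∈ c.sent, e.src = s.1 ∧ s ∈ e.msg.sigs

/-- Some message to `i` has been sent but not delivered yet. -/
def Config.Pending (c : Config P) (i : Fin n) : Prop :=
  ∃ id e, c.sent[id]? = some e ∧ e.dst = i ∧ id ∉ c.delivered

theorem Step.eq_or_receives (h : Step F c c') : c' = c ∨ ∃ i j m, Receives F c c' i j m := by
  cases h with
  | idle => exact .inl rfl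
  | deliver id e sent pending correct =>
    exact .inr ⟨e.dst, e.src, e.msg, correct, Function.update_self .., fun s hs =>
      Function.update_of_ne hs .., rfl, .inl (List.mem_of_getElem? sent)⟩
  | byzantine i j m correct faulty unforgeable =>
    exact .inr ⟨i, j, m, correct, Function.update_self .., fun s hs =>
      Function.update_of_ne hs .., rfl, .inr ⟨faulty, unforgeable⟩⟩

theorem Step.receives_of_delivered (h : Step F c c') {id : ℕ} (hid : id ∉ c.delivered)
    (hid' : id ∈ c'.delivered) :
    ∃ e, c.sent[id]? = some e ∧ Receives F c c' e.dst e.src e.msg := by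
  cases h with
  | idle => exact absurd hid' hid
  | deliver id' e sent pending correct =>
    obtain rfl : id = id' := hid'.resolve_right hid
    exact ⟨e, sent, correct, Function.update_self .., fun s hs =>
      Function.update_of_ne hs .., rfl, .inl (List.mem_of_getElem? sent)⟩
  | byzantine => exact absurd hid' hid

theorem Step.sent_prefix (h : Step F c c') : c.sent <+: c'.sent := by
  rcases h.eq_or_receives with rfl | ⟨i, j, m, h⟩
  · exact List.prefix_rfl
  · exact h.sent ▸ List.prefix_append _ _

theorem Step.delivered_subset (h : Step F c c') : c.delivered ⊆ c'.delivered := by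
  cases h with
  | idle | byzantine => exact subset_rfl
  | deliver => exact Set.subset_insert _ _

theorem Step.exists_receives_or_pending (h : Step F c c') (i : Fin n) :
    (∃ j m, Receives F c c' i j m) ∨ c'.state i = c.state i ∧ (c.Pending i → c'.Pending i) := by
  by_cases hi : ∃ j m, Receives F c c' i j m
  · exact .inl hi
  refine .inr ⟨?_, ?_⟩
  · rcases h.eq_or_receives with rfl | ⟨i', j, m, h'⟩
    · rfl
    · exact h'.state_of_ne i fun e => hi ⟨j, m, e ▸ h'⟩
  · rintro ⟨id, e, he, rfl, hid⟩
    refine ⟨id, e, getElem?_of_prefix h.sent_prefix he, rfl, fun hid' => hi ?_⟩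
    obtain ⟨e', he', h'⟩ := h.receives_of_delivered hid hid'
    obtain rfl : e = e' := Option.some.inj (he.symm.trans he')
    exact ⟨_, _, h'⟩

end Steps

namespace Execution

variable {P : Protocol n X} {F : Finset (Fin n)} {x : Fin n → X} (E : Execution P F x)

theorem sent_prefix {k k' : ℕ} (h : k ≤ k') : (E.conf k).sent <+: (E.conf k').sent := by
  induction h with
  | refl => exact List.prefix_rfl
  | step _ ih => exact ih.trans (E.step _).sent_prefix

theorem delivered_mono : Monotone fun k => (E.conf k).delivered :=
  monotone_nat_of_le_succ fun k => (E.step k).delivered_subset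

theorem state_zero (i : Fin n) : (E.conf 0).state i = (P.start i (x i)).1 := by
  rw [E.conf_zero]
  rfl

theorem delivered_zero : (E.conf 0).delivered = ∅ := by
  rw [E.conf_zero]
  rfl

theorem mem_sent_zero {e : Envelope n P.Data} :
    e ∈ (E.conf 0).sent ↔ e.src ∉ F ∧ (e.dst, e.msg) ∈ (P.start e.src (x e.src)).2 := by
  simp only [E.conf_zero, Config.initial, List.mem_flatMap, List.mem_filter, List.mem_finRange,
    true_and, decide_eq_true_eq, mem_envelopes]
  constructor
  · rintro ⟨i, hi, rfl, he⟩
    exact ⟨hi, he⟩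
  · rintro ⟨hi, he⟩
    exact ⟨_, hi, rfl, he⟩

theorem lt_length_of_mem_delivered {k id : ℕ} (h : id ∈ (E.conf k).delivered) :
    id < (E.conf k).sent.length := by
  induction k with
  | zero => simp [E.delivered_zero] at h
  | succ k ih =>
    refine lt_of_lt_of_le ?_ (E.step k).sent_prefix.length_le
    by_cases h' : id ∈ (E.conf k).delivered
    · exact ih h'
    · obtain ⟨e, he, -⟩ := (E.step k).receives_of_delivered h' h
      exact (List.getElem?_eq_some_iff.1 he).1

theorem state_mono {α : Type*} [Preorder α] (φ : P.State → α) {i : Fin n}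
    (h : ∀ st j m, φ st ≤ φ (P.step i st j m).1) : Monotone fun k => φ ((E.conf k).state i) := by
  refine monotone_nat_of_le_succ fun k => ?_
  rcases (E.step k).exists_receives_or_pending i with ⟨j, m, hr⟩ | ⟨hs, -⟩
  · rw [hr.state_self]
    exact h _ _ _
  · rw [hs]

theorem pending_of_mem {k : ℕ} {i j d : Fin n} {m m' : Msg n P.Data}
    (h : Receives F (E.conf k) (E.conf (k + 1)) i j m)
    (hm : (d, m') ∈ (P.step i ((E.conf k).state i) j m).2) : (E.conf (k + 1)).Pending d := by
  obtain ⟨p, hp, hget⟩ := List.mem_iff_getElem.1 (mem_envelopes (e := ⟨i, d, m'⟩).2 ⟨rfl, hm⟩)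
  refine ⟨(E.conf k).sent.length + p, ⟨i, d, m'⟩, ?_, rfl, fun hid => ?_⟩
  · rw [h.sent, List.getElem?_append_right (Nat.le_add_right ..), Nat.add_sub_cancel_left,
      List.getElem?_eq_getElem hp, hget]
  · have hid' : (E.conf k).sent.length + p ∉ (E.conf k).delivered := fun hd =>
      (E.lt_length_of_mem_delivered hd).not_ge (Nat.le_add_right ..)
    obtain ⟨e, he, -⟩ := (E.step k).receives_of_delivered hid' hid
    exact (List.getElem?_eq_some_iff.1 he).1.not_ge (Nat.le_add_right ..)

theorem src_notMem {k : ℕ} {e : Envelope n P.Data} (he : e ∈ (E.conf k).sent) : e.src ∉ F := by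
  induction k with
  | zero => exact (E.mem_sent_zero.1 he).1
  | succ k ih =>
    rcases (E.step k).eq_or_receives with hc | ⟨i, j, m, h⟩
    · exact ih (hc ▸ he)
    · rw [h.sent, List.mem_append] at he
      rcases he with he | he
      · exact ih he
      · exact (mem_envelopes.1 he).1 ▸ h.correct

theorem exists_state_of_mem_sent {Φ : Fin n → P.State → Fin n × Msg n P.Data → Prop}
    (start : ∀ i y, ∀ o ∈ (P.start i y).2, Φ i (P.start i y).1 o)
    (step : ∀ i st j m, ∀ o ∈ (P.step i st j m).2, Φ i (P.step i st j m).1 o)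
    {k : ℕ} {e : Envelope n P.Data} (he : e ∈ (E.conf k).sent) :
    ∃ k' ≤ k, Φ e.src ((E.conf k').state e.src) (e.dst, e.msg) := by
  induction k with
  | zero => exact ⟨0, le_rfl, E.state_zero _ ▸ start _ _ _ (E.mem_sent_zero.1 he).2⟩
  | succ k ih =>
    have old (he : e ∈ (E.conf k).sent) :
        ∃ k' ≤ k + 1, Φ e.src ((E.conf k').state e.src) (e.dst, e.msg) :=
      (ih he).imp fun k' h => ⟨h.1.trans k.le_succ, h.2⟩
    rcases (E.step k).eq_or_receives with hc | ⟨i, j, m, h⟩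
    · exact old (hc ▸ he)
    · rw [h.sent, List.mem_append] at he
      rcases he with he | he
      · exact old he
      · obtain ⟨rfl, ho⟩ := mem_envelopes.1 he
        exact ⟨k + 1, le_rfl, h.state_self ▸ step _ _ _ _ _ ho⟩

theorem length_sent_le_sum (β : Fin n → P.State → ℕ)
    (start : ∀ i y, (P.start i y).2.length ≤ β i (P.start i y).1)
    (step : ∀ i st j m, (P.step i st j m).2.length + β i st ≤ β i (P.step i st j m).1) (k : ℕ) :
    (E.conf k).sent.length ≤ ∑ i ∈ Fᶜ, β i ((E.conf k).state i) := by
  induction k with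
  | zero =>
    have key : (E.conf 0).sent.length = ∑ i ∈ Fᶜ, (P.start i (x i)).2.length := by
      rw [E.conf_zero]
      simp only [Config.initial, List.length_flatMap, length_envelopes]
      rw [← List.sum_toFinset _ ((List.nodup_finRange n).filter _)]
      congr 1
      ext i
      simp
    rw [key]
    exact Finset.sum_le_sum fun i _ => E.state_zero i ▸ start i (x i)
  | succ k ih =>
    rcases (E.step k).eq_or_receives with hc | ⟨i, j, m, h⟩
    · rwa [hc]
    · have hi : i ∈ Fᶜ := Finset.mem_compl.2 h.correct
      have hrest : ∑ s ∈ Fᶜ \ {i}, β s ((E.conf (k + 1)).state s) =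
          ∑ s ∈ Fᶜ \ {i}, β s ((E.conf k).state s) := by
        refine Finset.sum_congr rfl fun s hs => ?_
        rw [h.state_of_ne s (by simpa using (Finset.mem_sdiff.1 hs).2)]
      have hstep := step i ((E.conf k).state i) j m
      rw [Finset.sum_eq_sum_sdiff_singleton_add hi] at ih ⊢
      rw [hrest, h.sent, List.length_append, length_envelopes, h.state_self]
      omega

theorem decides_of_output_stable (h : ∀ i st j m y, P.output st = some y →
      P.output (P.step i st j m).1 = some y) {k : ℕ} {i : Fin n} {y : X}
    (hy : E.out k i = some y) : E.Decides i y := by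
  have final (z : X) : Monotone fun k => E.out k i = some z :=
    E.state_mono (fun st => P.output st = some z) fun st j m => h i st j m z
  refine ⟨⟨k, hy⟩, fun k' z hz => ?_, fun k k' hk => final y hk⟩
  exact Option.some.inj ((final z (le_max_right k k') hz).symm.trans
    (final y (le_max_left k k') hy))

theorem isRoundTiming_zero : E.IsRoundTiming 0 :=
  ⟨rfl, monotone_const, fun _ _ _ _ _ _ _ => by simp⟩

variable {E} {τ : ℕ → ℝ}

theorem IsRoundTiming.exists_receives (T : E.IsRoundTiming τ) {k id : ℕ} {e : Envelope n P.Data}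
    (he : (E.conf k).sent[id]? = some e) (hdst : e.dst ∉ F) :
    ∃ a, τ (a + 1) ≤ τ k + 1 ∧ Receives F (E.conf a) (E.conf (a + 1)) e.dst e.src e.msg ∧
      (id ∉ (E.conf k).delivered → k ≤ a) := by
  classical
  have hex := E.reliable k id e he hdst
  obtain ⟨a, ha⟩ : ∃ a, Nat.find hex = a + 1 := by
    refine Nat.exists_eq_succ_of_ne_zero fun h => ?_
    have := Nat.find_spec hex
    rw [h, E.delivered_zero] at this
    exact this
  have hid : id ∉ (E.conf a).delivered := Nat.find_min hex (by omega)
  have hid' : id ∈ (E.conf (a + 1)).delivered := ha ▸ Nat.find_spec hex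
  obtain ⟨e', he', hr⟩ := (E.step a).receives_of_delivered hid hid'
  obtain rfl : e = e' := by
    rcases le_total a k with h | h
    · exact Option.some.inj (he.symm.trans (getElem?_of_prefix (E.sent_prefix h) he'))
    · exact Option.some.inj ((getElem?_of_prefix (E.sent_prefix h) he).symm.trans he')
  refine ⟨a, T.delay k id e he hdst a hid, hr, fun hk => ?_⟩
  by_contra! h
  exact hk (E.delivered_mono h hid')

theorem IsRoundTiming.exists_receives_of_mem (T : E.IsRoundTiming τ) {k : ℕ} {i j : Fin n}
    {m : Msg n P.Data} (he : ⟨j, i, m⟩ ∈ (E.conf k).sent) (hi : i ∉ F) :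
    ∃ a, τ (a + 1) ≤ τ k + 1 ∧ Receives F (E.conf a) (E.conf (a + 1)) i j m := by
  obtain ⟨id, hid⟩ := List.mem_iff_getElem?.1 he
  obtain ⟨a, ha, hr, -⟩ := T.exists_receives hid hi
  exact ⟨a, ha, hr⟩

theorem IsRoundTiming.exists_receives_of_pending (T : E.IsRoundTiming τ) {k : ℕ} {i : Fin n}
    (h : (E.conf k).Pending i) (hi : i ∉ F) :
    ∃ a, k ≤ a ∧ τ (a + 1) ≤ τ k + 1 ∧
      ∃ j m, Receives F (E.conf a) (E.conf (a + 1)) i j m := by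
  obtain ⟨id, e, he, rfl, hid⟩ := h
  obtain ⟨a, ha, hr, hk⟩ := T.exists_receives he hi
  exact ⟨a, hk hid, ha, _, _, hr⟩

theorem IsRoundTiming.exists_forall (T : E.IsRoundTiming τ) {ι : Type*} (s : Finset ι)
    {p : ι → ℕ → Prop} (hp : ∀ i ∈ s, Monotone (p i)) {t : ℝ} (ht : 0 ≤ t)
    (h : ∀ i ∈ s, ∃ k, τ k ≤ t ∧ p i k) : ∃ k, τ k ≤ t ∧ ∀ i ∈ s, p i k := by
  classical
  induction s using Finset.induction_on with
  | empty => exact ⟨0, T.zero.trans_le ht, by simp⟩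
  | insert i s _ ih =>
    obtain ⟨k, hk, hpk⟩ := ih (fun i hi => hp i (Finset.mem_insert_of_mem hi))
      fun i hi => h i (Finset.mem_insert_of_mem hi)
    obtain ⟨k', hk', hpk'⟩ := h i (Finset.mem_insert_self ..)
    refine ⟨max k k', ?_, Finset.forall_mem_insert .. |>.2 ⟨?_, fun s' hs' => ?_⟩⟩
    · rcases max_choice k k' with hmax | hmax <;> rwa [hmax]
    · exact hp i (Finset.mem_insert_self ..) (le_max_right k k') hpk'
    · exact hp s' (Finset.mem_insert_of_mem hs') (le_max_left k k') (hpk s' hs')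

end Execution

theorem Solves.mono [SemilatticeSup X] {P : Protocol n X} {f T T' M M' : ℕ}
    (h : Solves P f T M) (hT : T ≤ T') (hM : M ≤ M') : Solves P f T' M' where
  signsHonestly := h.signsHonestly
  agreement := h.agreement
  rounds F hF x E τ hτ i hi := by
    obtain ⟨k, hk, hout⟩ := h.rounds F hF x E τ hτ i hi
    exact ⟨k, hk.trans (Nat.cast_le.2 hT), hout⟩
  messages F hF x E k := (h.messages F hF x E k).trans hM

theorem exists_isLUB_image_compl [SemilatticeSup X] {F : Finset (Fin n)} (hF : ∃ i, i ∉ F)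
    (y : Fin n → X) (B : Finset X) : ∃ u, IsLUB ({a | ∃ i ∉ F, y i = a} ∪ (B : Set X)) u := by
  classical
  obtain ⟨i, hi⟩ := hF
  have hne : (Fᶜ.image y ∪ B).Nonempty :=
    ⟨y i, Finset.mem_union_left _ (Finset.mem_image_of_mem y (Finset.mem_compl.2 hi))⟩
  refine ⟨(Fᶜ.image y ∪ B).sup' hne id, ?_⟩
  convert Finset.isLUB_sup' hne using 1
  ext a
  simp

theorem isBLA_of_chain [SemilatticeSup X] {F : Finset (Fin n)} {x y : Fin n → X}
    {C : Finset (Fin n × X)} {V : Fin n → Finset (Fin n × X)} (hF : ∃ i, i ∉ F)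
    (injOn : Set.InjOn Prod.fst (C : Set (Fin n × X)))
    (eq_input : ∀ e ∈ C, e.1 ∉ F → e.2 = x e.1) (subset : ∀ i ∉ F, V i ⊆ C)
    (own_mem : ∀ i ∉ F, (i, x i) ∈ V i) (chain : ∀ i ∉ F, ∀ j ∉ F, V i ⊆ V j ∨ V j ⊆ V i)
    (isLUB : ∀ i ∉ F, IsLUB (Prod.snd '' (V i : Set (Fin n × X))) (y i)) : IsBLA F x y where
  comparability i hi j hj :=
    (chain i hi j hj).imp
      (fun h => (isLUB i hi).mono (isLUB j hj) (Set.image_mono (Finset.coe_subset.2 h)))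
      fun h => (isLUB j hj).mono (isLUB i hi) (Set.image_mono (Finset.coe_subset.2 h))
  downward_validity i hi := (isLUB i hi).1 ⟨_, own_mem i hi, rfl⟩
  upward_validity := by
    classical
    set D := C.filter fun e => e.1 ∈ F
    obtain ⟨u, hu⟩ := exists_isLUB_image_compl hF y ∅
    obtain ⟨v, hv⟩ := exists_isLUB_image_compl hF x (D.image Prod.snd)
    rw [Finset.coe_empty, Set.union_empty] at hu
    refine ⟨D.image Prod.snd, ?_, u, v, hu, hv, hu.2 ?_⟩
    · calc (D.image Prod.snd).card ≤ D.card := Finset.card_image_le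
        _ = (D.image Prod.fst).card := (Finset.card_image_of_injOn
          (injOn.mono (Finset.coe_subset.2 (Finset.filter_subset ..)))).symm
        _ ≤ F.card := Finset.card_le_card (Finset.image_subset_iff.2 fun e he =>
          (Finset.mem_filter.1 he).2)
    · rintro _ ⟨i, hi, rfl⟩
      refine (isLUB i hi).2 ?_
      rintro _ ⟨e, he, rfl⟩
      have heC := subset i hi he
      by_cases heF : e.1 ∈ F
      · exact hv.1 (.inr (Finset.mem_coe.2 (Finset.mem_image_of_mem _
          (Finset.mem_filter.2 ⟨heC, heF⟩))))
      · exact hv.1 (.inl ⟨e.1, heF, (eq_input e heC heF).symm⟩)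

end AuthBLA

namespace AuthBLA.Halving

universe u

variable {n f : ℕ} {X : Type u}

/-- Sets of proposed inputs, each with the process that proposed it. -/
abbrev Value (n : ℕ) (X : Type u) : Type u := Finset (Fin n × X)

/-- The groups are the nodes of a binary tree, given by the turns that lead to them from the root,
the last turn first. `true` leads to the larger values. -/
abbrev Group : Type := List Bool

/-- What a process may ask the others for: a certificate of its input, the acceptance of `V` in the
group `g`, and the values accepted in `g` after `V`. The query `publish` only tells them the
certificate and waits until enough others have told theirs. -/
inductive Query (n : ℕ) (X : Type u) : Type u
  | certify
  | publish
  | write (g : Group) (V : Value n X)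
  | read (g : Group) (V : Value n X)

/-- Plain data in messages: the facts that processes sign, and requests. `saw g V S` states that
a quorum has accepted `V` in the group `g` and that the signer itself has accepted exactly the
values in `S` there. -/
inductive Datum (n : ℕ) (X : Type u) : Type u
  | input (x : X)
  | certified (j : Fin n) (x : X)
  | wrote (g : Group) (V : Value n X)
  | saw (g : Group) (V : Value n X) (S : Finset (Value n X))
  | request (r : Query n X)

/-- Sets of signed facts, each with its signer. -/
abbrev Facts (n : ℕ) (X : Type u) : Type u := Set (Fin n × Datum n X)

/-- At least `n - f` processes have signed `φ`. -/
def Quorum (f : ℕ) (K : Facts n X) (φ : Datum n X) : Prop :=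
  ∃ Q : Finset (Fin n), n - f ≤ Q.card ∧ ∀ s ∈ Q, (s, φ) ∈ K

/-- The depth of the tree of groups. -/
def depth (f : ℕ) : ℕ := Nat.log 2 f + 1

/-- Values in the group `g` have at least this size. The sizes of values range over an interval of
at most `f + 1 ≤ 2 ^ depth f` numbers at the root, and each turn halves this interval. -/
def threshold (n f : ℕ) : Group → ℕ
  | [] => n - f
  | false :: g => threshold n f g
  | true :: g => threshold n f g + 2 ^ (depth f - (g.length + 1))

/-- The size at which the group `g` is split. -/
def middle (n f : ℕ) (g : Group) : ℕ := threshold n f (true :: g)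

open Classical in
/-- The union of all values reported by the processes in `Q`. -/
noncomputable def gather (Q : Finset (Fin n)) (S : Fin n → Finset (Value n X)) : Value n X :=
  Q.biUnion fun s => (S s).biUnion id

/-- The quorum `Q` has answered the query `read g V` with the reports `S`. -/
structure Answers (f : ℕ) (K : Facts n X) (g : Group) (V : Value n X) (Q : Finset (Fin n))
    (S : Fin n → Finset (Value n X)) : Prop where
  card : n - f ≤ Q.card
  mem : ∀ s ∈ Q, (s, .saw g V (S s)) ∈ K

/-- The values that arise from those with property `E` by reading in the group `g`. -/
inductive Closure (f : ℕ) (K : Facts n X) (g : Group) (E : Value n X → Prop) : Value n X → Prop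
  | base {V : Value n X} (h : E V) : Closure f K g E V
  | join {V : Value n X} {Q : Finset (Fin n)} {S : Fin n → Finset (Value n X)}
      (ans : Answers f K g V Q S) (val : ∀ s ∈ Q, ∀ W ∈ S s, Closure f K g E W) :
      Closure f K g E (gather Q S)

/-- The facts in `K` prove that `U` is a result of the query `read g V`, if only values in the
closure of `E` may be reported. -/
def ReadsIn (f : ℕ) (K : Facts n X) (g : Group) (E : Value n X → Prop) (V U : Value n X) : Prop :=
  ∃ Q S, Answers f K g V Q S ∧ (∀ s ∈ Q, ∀ W ∈ S s, Closure f K g E W) ∧ gather Q S = U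

/-- The values with which a process may enter the group `g`: certified inputs at the root, the
value `V` that was written if the read result `U` is small, and `U` if `V` is large. -/
def Entry (f : ℕ) (K : Facts n X) : Group → Value n X → Prop
  | [], V => (∀ e ∈ V, Quorum f K (.certified e.1 e.2)) ∧ n - f ≤ V.card
  | false :: g, V => ∃ U, ReadsIn f K g (Entry f K g) V U ∧ U.card < middle n f g
  | true :: g, U => ∃ V, ReadsIn f K g (Entry f K g) V U ∧ middle n f g ≤ V.card

/-- The facts in `K` prove that `V` may be written in the group `g`. -/
def Valid (f : ℕ) (K : Facts n X) (g : Group) (V : Value n X) : Prop :=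
  Closure f K g (Entry f K g) V

/-- The facts in `K` prove that `U` is a result of the query `read g V`. -/
def Reads (f : ℕ) (K : Facts n X) (g : Group) (V U : Value n X) : Prop :=
  ReadsIn f K g (Entry f K g) V U

theorem mem_gather {Q : Finset (Fin n)} {S : Fin n → Finset (Value n X)} {e : Fin n × X} :
    e ∈ gather Q S ↔ ∃ s ∈ Q, ∃ W ∈ S s, e ∈ W := by
  simp [gather]

theorem subset_gather {Q : Finset (Fin n)} {S : Fin n → Finset (Value n X)} {s : Fin n}
    {W : Value n X} (hs : s ∈ Q) (hW : W ∈ S s) : W ⊆ gather Q S :=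
  fun _ he => mem_gather.2 ⟨s, hs, W, hW, he⟩

section Mono

variable {K K' : Facts n X} {g : Group} {E E' : Value n X → Prop} {V U : Value n X}

theorem Quorum.mono (h : K ⊆ K') {φ : Datum n X} : Quorum f K φ → Quorum f K' φ :=
  fun ⟨Q, hQ, hs⟩ => ⟨Q, hQ, fun s hs' => h (hs s hs')⟩

theorem Answers.mono (h : K ⊆ K') {Q : Finset (Fin n)} {S : Fin n → Finset (Value n X)}
    (a : Answers f K g V Q S) : Answers f K' g V Q S :=
  ⟨a.card, fun s hs => h (a.mem s hs)⟩

theorem Closure.mono (h : K ⊆ K') (hE : ∀ V, E V → E' V) (v : Closure f K g E V) :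
    Closure f K' g E' V := by
  induction v with
  | base hV => exact .base (hE _ hV)
  | join ans _ ih => exact .join (ans.mono h) ih

theorem ReadsIn.mono (h : K ⊆ K') (hE : ∀ V, E V → E' V) :
    ReadsIn f K g E V U → ReadsIn f K' g E' V U :=
  fun ⟨Q, S, a, v, hU⟩ => ⟨Q, S, a.mono h, fun s hs W hW => (v s hs W hW).mono h hE, hU⟩

theorem Entry.mono (h : K ⊆ K') : ∀ g (V : Value n X), Entry f K g V → Entry f K' g V
  | [], _, hV => ⟨fun e he => (hV.1 e he).mono h, hV.2⟩
  | false :: g, _, ⟨U, r, hU⟩ => ⟨U, r.mono h (Entry.mono h g), hU⟩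
  | true :: g, _, ⟨V, r, hV⟩ => ⟨V, r.mono h (Entry.mono h g), hV⟩

theorem Valid.mono (h : K ⊆ K') (v : Valid f K g V) : Valid f K' g V :=
  Closure.mono h (Entry.mono h g) v

theorem Reads.mono (h : K ⊆ K') (r : Reads f K g V U) : Reads f K' g V U :=
  ReadsIn.mono h (Entry.mono h g) r

end Mono

theorem Reads.valid {K : Facts n X} {g : Group} {V U : Value n X} (r : Reads f K g V U) :
    Valid f K g U := by
  obtain ⟨Q, S, a, v, rfl⟩ := r
  exact .join a v

theorem Closure.subset {K : Facts n X} {g : Group} {E : Value n X → Prop} {V : Value n X}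
    (v : Closure f K g E V) {H : Set (Fin n × X)} (h : ∀ V₀, E V₀ → (V₀ : Set (Fin n × X)) ⊆ H) :
    (V : Set (Fin n × X)) ⊆ H := by
  induction v with
  | base hV => exact h _ hV
  | join _ _ ih =>
    intro e he
    obtain ⟨s, hs, W, hW, he⟩ := mem_gather.1 he
    exact ih s hs W hW he

theorem middle_eq (g : Group) :
    middle n f g = threshold n f g + 2 ^ (depth f - (g.length + 1)) :=
  rfl

theorem two_pow_depth_sub {ℓ : ℕ} (h : ℓ < depth f) :
    2 ^ (depth f - ℓ) = 2 ^ (depth f - (ℓ + 1)) + 2 ^ (depth f - (ℓ + 1)) := by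
  rw [← two_mul, ← pow_succ']
  congr 1
  omega

theorem lt_two_pow_depth (f : ℕ) : f < 2 ^ depth f := Nat.lt_pow_succ_log_self one_lt_two f

/-- The facts signed during an execution, as far as safety depends on them: `G k` are those that
exist at time `k`. -/
structure Run (f : ℕ) (F : Finset (Fin n)) (x : Fin n → X) (G : ℕ → Facts n X) : Prop where
  resilient : 3 * f < n
  faulty_card : F.card ≤ f
  mono : Monotone G
  input_eq : ∀ k, ∀ s ∉ F, ∀ y, (s, .input y) ∈ G k → y = x s
  input_mem : ∀ k, ∀ s ∉ F, ∀ j y, (s, .certified j y) ∈ G k → (j, .input y) ∈ G k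
  certified_unique : ∀ k, ∀ s ∉ F, ∀ j y z, (s, .certified j y) ∈ G k →
    (s, .certified j z) ∈ G k → y = z
  wrote_valid : ∀ k, ∀ s ∉ F, ∀ g V, (s, .wrote g V) ∈ G k → Valid f (G k) g V
  saw_after : ∀ k, ∀ s ∉ F, ∀ g V S, (s, .saw g V S) ∈ G k →
    ∃ k', Quorum f (G k') (.wrote g V) ∧ ∀ W, (s, .wrote g W) ∈ G k' → W ∈ S

/-- All the facts that are ever signed. -/
def total (G : ℕ → Facts n X) : Facts n X := ⋃ k, G k

theorem subset_total (G : ℕ → Facts n X) (k : ℕ) : G k ⊆ total G := Set.subset_iUnion G k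

/-- The first time at which a quorum has accepted `V` in the group `g`. -/
noncomputable def completion (f : ℕ) (G : ℕ → Facts n X) (g : Group) (V : Value n X) : ℕ :=
  sInf {k | Quorum f (G k) (.wrote g V)}

/-- All certified inputs. -/
def certifiedSet (f : ℕ) (G : ℕ → Facts n X) : Set (Fin n × X) :=
  {e | Quorum f (total G) (.certified e.1 e.2)}

/-- Every value of the group `g` is contained in every value of the group `g'`. -/
def Below (f : ℕ) (K : Facts n X) (g g' : Group) : Prop :=
  ∀ V V', Valid f K g V → Valid f K g' V' → V ⊆ V'

theorem exists_correct_of_card {F : Finset (Fin n)} (hf : 3 * f < n) (hF : F.card ≤ f)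
    {Q Q' : Finset (Fin n)} (hQ : n - f ≤ Q.card) (hQ' : n - f ≤ Q'.card) :
    ∃ s ∈ Q, s ∈ Q' ∧ s ∉ F := by
  by_contra! h
  have h1 : (Q ∩ Q').card ≤ F.card := Finset.card_le_card fun s hs =>
    h s (Finset.mem_inter.1 hs).1 (Finset.mem_inter.1 hs).2
  have h2 := Finset.card_union_add_card_inter Q Q'
  have h3 : (Q ∪ Q').card ≤ n := (Finset.card_le_univ _).trans_eq (Fintype.card_fin n)
  omega

namespace Run

variable {F : Finset (Fin n)} {x : Fin n → X} {G : ℕ → Facts n X} {g g' : Group}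
  {V U W T : Value n X}

theorem exists_correct (R : Run f F x G) {φ ψ : Datum n X} (hφ : Quorum f (total G) φ)
    (hψ : Quorum f (total G) ψ) : ∃ s ∉ F, ∃ k, (s, φ) ∈ G k ∧ (s, ψ) ∈ G k := by
  obtain ⟨Q, hQ, hs⟩ := hφ
  obtain ⟨Q', hQ', hs'⟩ := hψ
  obtain ⟨s, hsQ, hsQ', hsF⟩ := exists_correct_of_card R.resilient R.faulty_card hQ hQ'
  obtain ⟨k, hk⟩ := Set.mem_iUnion.1 (hs s hsQ)
  obtain ⟨k', hk'⟩ := Set.mem_iUnion.1 (hs' s hsQ')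
  exact ⟨s, hsF, max k k', R.mono (le_max_left _ _) hk, R.mono (le_max_right _ _) hk'⟩

theorem le_card_compl (R : Run f F x G) : n - f ≤ Fᶜ.card := by
  rw [Finset.card_compl, Fintype.card_fin]
  exact Nat.sub_le_sub_left R.faulty_card n

theorem exists_quorum_of_answers (R : Run f F x G) {Q : Finset (Fin n)}
    {S : Fin n → Finset (Value n X)} (a : Answers f (total G) g V Q S) :
    ∃ k, Quorum f (G k) (.wrote g V) := by
  obtain ⟨s, hs, -, hsF⟩ := exists_correct_of_card R.resilient R.faulty_card a.card a.card
  obtain ⟨k, hk⟩ := Set.mem_iUnion.1 (a.mem s hs)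
  obtain ⟨k', h, -⟩ := R.saw_after k s hsF g V _ hk
  exact ⟨k', h⟩

theorem exists_mem_of_completion_le (R : Run f F x G) {Q : Finset (Fin n)}
    {S : Fin n → Finset (Value n X)} (a : Answers f (total G) g W Q S) {k : ℕ}
    (hV : Quorum f (G k) (.wrote g V)) (h : completion f G g V ≤ completion f G g W) :
    ∃ s ∈ Q, V ∈ S s := by
  obtain ⟨Q', hQ', hs'⟩ : Quorum f (G (completion f G g V)) (.wrote g V) :=
    Nat.sInf_mem (s := {k | Quorum f (G k) (.wrote g V)}) ⟨k, hV⟩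
  obtain ⟨s, hs, hsQ, hsF⟩ := exists_correct_of_card R.resilient R.faulty_card hQ' a.card
  obtain ⟨k₁, hk₁⟩ := Set.mem_iUnion.1 (a.mem s hsQ)
  obtain ⟨k₂, h₂, h₃⟩ := R.saw_after k₁ s hsF g W _ hk₁
  have hle : completion f G g W ≤ k₂ := Nat.sInf_le h₂
  exact ⟨s, hsQ, h₃ V (R.mono (h.trans hle) (hs' s hs))⟩

theorem exists_quorum_of_reads (R : Run f F x G) (r : Reads f (total G) g V U) :
    ∃ k, Quorum f (G k) (.wrote g V) := by
  obtain ⟨Q, S, a, -, -⟩ := r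
  exact R.exists_quorum_of_answers a

theorem subset_of_completion_le (R : Run f F x G) (rV : Reads f (total G) g V U)
    (rW : Reads f (total G) g W T) (h : completion f G g V ≤ completion f G g W) : V ⊆ T := by
  obtain ⟨k, hk⟩ := R.exists_quorum_of_reads rV
  obtain ⟨Q, S, a, -, rfl⟩ := rW
  obtain ⟨s, hs, hV⟩ := R.exists_mem_of_completion_le a hk h
  exact subset_gather hs hV

theorem reads_subset (R : Run f F x G) (r : Reads f (total G) g V U) : V ⊆ U :=
  R.subset_of_completion_le r r le_rfl

theorem valid_of_reads (R : Run f F x G) (r : Reads f (total G) g V U) :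
    Valid f (total G) g V := by
  obtain ⟨k, hk⟩ := R.exists_quorum_of_reads r
  have hq := hk.mono (subset_total G k)
  obtain ⟨s, hsF, k', hs, -⟩ := R.exists_correct hq hq
  exact (R.wrote_valid k' s hsF g V hs).mono (subset_total G k')

theorem valid_of_entry_cons (R : Run f F x G) {b : Bool} (h : Entry f (total G) (b :: g) V) :
    Valid f (total G) g V := by
  cases b with
  | false =>
    obtain ⟨U, r, -⟩ := h
    exact R.valid_of_reads r
  | true =>
    obtain ⟨W, r, -⟩ := h
    exact Reads.valid r

theorem exists_entry_subset (R : Run f F x G) (v : Valid f (total G) g V) :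
    ∃ V₀, Entry f (total G) g V₀ ∧ V₀ ⊆ V := by
  induction v with
  | base h => exact ⟨_, h, subset_rfl⟩
  | join ans _ ih =>
    obtain ⟨k, hk⟩ := R.exists_quorum_of_answers ans
    obtain ⟨s, hs, hV⟩ := R.exists_mem_of_completion_le ans hk le_rfl
    obtain ⟨V₀, h₀, hsub⟩ := ih s hs _ hV
    exact ⟨V₀, h₀, hsub.trans (subset_gather hs hV)⟩

theorem coe_subset_certifiedSet (R : Run f F x G) (v : Valid f (total G) g V) :
    (V : Set (Fin n × X)) ⊆ certifiedSet f G := by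
  induction g generalizing V with
  | nil => exact Closure.subset v fun V₀ h₀ => h₀.1
  | cons b g ih => exact Closure.subset v fun V₀ h₀ => ih (R.valid_of_entry_cons h₀)

theorem injOn_certifiedSet (R : Run f F x G) : Set.InjOn Prod.fst (certifiedSet f G) := by
  rintro ⟨j, y⟩ hy ⟨j', z⟩ hz (rfl : j = j')
  obtain ⟨s, hsF, k, hk, hk'⟩ := R.exists_correct hy hz
  rw [R.certified_unique k s hsF j y z hk hk']

theorem eq_input_of_mem_certifiedSet (R : Run f F x G) {e : Fin n × X}
    (he : e ∈ certifiedSet f G) (heF : e.1 ∉ F) : e.2 = x e.1 := by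
  obtain ⟨s, hsF, k, hk, -⟩ := R.exists_correct he he
  exact R.input_eq k e.1 heF e.2 (R.input_mem k s hsF e.1 e.2 hk)

theorem finite_certifiedSet (R : Run f F x G) : (certifiedSet f G).Finite :=
  Set.Finite.of_finite_image (Set.toFinite _) R.injOn_certifiedSet

theorem card_certifiedSet_le (R : Run f F x G) : R.finite_certifiedSet.toFinset.card ≤ n := by
  classical
  rw [← Finset.card_image_of_injOn (f := Prod.fst) (by simpa using R.injOn_certifiedSet)]
  exact (Finset.card_le_univ _).trans_eq (Fintype.card_fin n)

theorem threshold_le_card (R : Run f F x G) (v : Valid f (total G) g V) :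
    threshold n f g ≤ V.card := by
  induction g generalizing V with
  | nil =>
    obtain ⟨V₀, h₀, hsub⟩ := R.exists_entry_subset v
    exact h₀.2.trans (Finset.card_le_card hsub)
  | cons b g ih =>
    obtain ⟨V₀, h₀, hsub⟩ := R.exists_entry_subset v
    refine le_trans ?_ (Finset.card_le_card hsub)
    cases b with
    | false => exact ih (R.valid_of_entry_cons h₀)
    | true =>
      obtain ⟨W, r, hW⟩ := h₀
      exact hW.trans (Finset.card_le_card (R.reads_subset r))

theorem exists_bound_low (R : Run f F x G) {H : Value n X}
    (hH : ∀ V, Valid f (total G) g V → V ⊆ H) :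
    ∃ H' : Value n X, H'.card < middle n f g ∧ ∀ V, Valid f (total G) (false :: g) V → V ⊆ H' := by
  have hfin : {V | Entry f (total G) (false :: g) V}.Finite :=
    H.powerset.finite_toSet.subset fun V hV =>
      Finset.mem_powerset.2 (hH V (R.valid_of_entry_cons hV))
  rcases Set.eq_empty_or_nonempty {V | Entry f (total G) (false :: g) V} with hemp | hne
  · refine ⟨∅, by simp [middle_eq], fun V v => Finset.coe_subset.1 (Closure.subset v ?_)⟩
    exact fun V₀ h₀ => (Set.eq_empty_iff_forall_notMem.1 hemp V₀ h₀).elim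
  · -- the read that follows the last completed write of an entry sees all entries
    obtain ⟨W, ⟨U, rW, hU⟩, hmax⟩ := Set.exists_max_image _ (completion f G g) hfin hne
    refine ⟨U, hU, fun V v => Finset.coe_subset.1 (Closure.subset v fun V₀ h₀ => ?_)⟩
    obtain ⟨U₀, r₀, -⟩ := id h₀
    exact Finset.coe_subset.2 (R.subset_of_completion_le r₀ rW (hmax V₀ h₀))

theorem exists_bound (R : Run f F x G) (hg : g.length ≤ depth f) :
    ∃ H : Value n X, H.card < threshold n f g + 2 ^ (depth f - g.length) ∧
      ∀ V, Valid f (total G) g V → V ⊆ H := by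
  induction g with
  | nil =>
    refine ⟨R.finite_certifiedSet.toFinset, ?_, fun V v e he => ?_⟩
    · have h₁ := R.card_certifiedSet_le
      have h₂ : f < 2 ^ (depth f - ([] : Group).length) := lt_two_pow_depth f
      unfold threshold
      omega
    · exact R.finite_certifiedSet.mem_toFinset.2 (R.coe_subset_certifiedSet v he)
  | cons b g ih =>
    rw [List.length_cons] at hg
    obtain ⟨H, hH, hsub⟩ := ih (by omega)
    cases b with
    | false => exact R.exists_bound_low hsub
    | true =>
      refine ⟨H, ?_, fun V v => Finset.coe_subset.1 (Closure.subset v fun V₀ h₀ => ?_)⟩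
      · rw [two_pow_depth_sub (by omega), ← add_assoc] at hH
        exact hH
      · exact Finset.coe_subset.2 (hsub V₀ (R.valid_of_entry_cons h₀))

theorem below_of_entries (R : Run f F x G)
    (h : ∀ V V', Entry f (total G) g V → Entry f (total G) g' V' → V ⊆ V') :
    Below f (total G) g g' := by
  intro V V' v v'
  obtain ⟨V₀, h₀, hsub⟩ := R.exists_entry_subset v'
  exact Finset.coe_subset.1 (Closure.subset v fun V₁ h₁ =>
    Finset.coe_subset.2 ((h V₁ V₀ h₁ h₀).trans hsub))

theorem below_cons (R : Run f F x G) (h : Below f (total G) g g') (b b' : Bool) :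
    Below f (total G) (b :: g) (b' :: g') :=
  R.below_of_entries fun V V' hV hV' =>
    h V V' (R.valid_of_entry_cons hV) (R.valid_of_entry_cons hV')

theorem below_false_true (R : Run f F x G) (g : Group) :
    Below f (total G) (false :: g) (true :: g) := by
  refine R.below_of_entries ?_
  rintro V T ⟨U, rV, hU⟩ ⟨W, rW, hW⟩
  rcases le_total (completion f G g V) (completion f G g W) with h | h
  · exact R.subset_of_completion_le rV rW h
  · have := Finset.card_le_card (R.subset_of_completion_le rW rV h)
    omega

theorem below_or_below (R : Run f F x G) (hlen : g.length = g'.length) (hne : g ≠ g') :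
    Below f (total G) g g' ∨ Below f (total G) g' g := by
  induction g generalizing g' with
  | nil => exact absurd (List.length_eq_zero_iff.1 hlen.symm).symm hne
  | cons b g ih =>
    obtain ⟨b', g', rfl⟩ := List.exists_cons_of_length_eq_add_one hlen.symm
    by_cases hg : g = g'
    · subst hg
      cases b <;> cases b'
      · exact absurd rfl hne
      · exact .inl (R.below_false_true g)
      · exact .inr (R.below_false_true g)
      · exact absurd rfl hne
    · exact (ih (Nat.succ.inj hlen) hg).imp (R.below_cons · b b') (R.below_cons · b' b)

theorem comparable (R : Run f F x G) (hg : g.length = depth f) (hg' : g'.length = depth f)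
    (v : Valid f (total G) g V) (w : Valid f (total G) g' W) : V ⊆ W ∨ W ⊆ V := by
  rcases eq_or_ne g g' with rfl | hne
  · obtain ⟨H, hH, hsub⟩ := R.exists_bound hg.le
    rw [hg, Nat.sub_self, pow_zero] at hH
    have eq_bound {V : Value n X} (v : Valid f (total G) g V) : V = H :=
      Finset.eq_of_subset_of_card_le (hsub V v)
        ((Nat.lt_succ_iff.1 hH).trans (R.threshold_le_card v))
    exact .inl (by rw [eq_bound v, eq_bound w])
  · exact (R.below_or_below (hg.trans hg'.symm) hne).imp (· V W v w) (· W V w v)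

end Run

/-- The position of a query in the order in which a process asks them. -/
def slot (n f : ℕ) : Query n X → ℕ
  | .certify => 0
  | .publish => 1
  | .write g V => 4 * g.length + 2 + if middle n f g ≤ V.card then 2 else 0
  | .read g V => 4 * g.length + 3 + if middle n f g ≤ V.card then 2 else 0

/-- If process `s` knows the facts in `K`, it may answer a query of process `j` by signing a
datum. Queries `publish` are not answered, nor are those in the leaves of the tree. -/
inductive Grants (f : ℕ) (s : Fin n) (K : Facts n X) (j : Fin n) : Query n X → Datum n X → Prop
  | certify {y : X} (mem : (j, .input y) ∈ K) : Grants f s K j .certify (.certified j y)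
  | write {g : Group} {V : Value n X} (lt : g.length < depth f) (valid : Valid f K g V) :
      Grants f s K j (.write g V) (.wrote g V)
  | read {g : Group} {V : Value n X} {S : Finset (Value n X)} (lt : g.length < depth f)
      (quorum : Quorum f K (.wrote g V)) (mem_iff : ∀ W, W ∈ S ↔ (s, .wrote g W) ∈ K) :
      Grants f s K j (.read g V) (.saw g V S)

/-- If process `i` knows the facts in `K`, it may proceed from one query to another. -/
inductive Next (f : ℕ) (i : Fin n) (K : Facts n X) : Query n X → Query n X → Prop
  | publish {y : X} (quorum : Quorum f K (.certified i y)) : Next f i K .certify .publish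
  | start {V : Value n X} {y : X} (entry : Entry f K [] V) (own : (i, y) ∈ V) :
      Next f i K .publish (.write [] V)
  | read {g : Group} {V : Value n X} (lt : g.length < depth f)
      (quorum : Quorum f K (.wrote g V)) : Next f i K (.write g V) (.read g V)
  | join {g : Group} {V U : Value n X} (lt : g.length < depth f) (reads : Reads f K g V U)
      (card : V.card < middle n f g) (card' : middle n f g ≤ U.card) :
      Next f i K (.read g V) (.write g U)
  | low {g : Group} {V U : Value n X} (lt : g.length < depth f) (reads : Reads f K g V U)
      (card : U.card < middle n f g) : Next f i K (.read g V) (.write (false :: g) V)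
  | high {g : Group} {V U : Value n X} (lt : g.length < depth f) (reads : Reads f K g V U)
      (card : middle n f g ≤ V.card) : Next f i K (.read g V) (.write (true :: g) U)

theorem Next.mono {K K' : Facts n X} (h : K ⊆ K') {i : Fin n} {r r' : Query n X} :
    Next f i K r r' → Next f i K' r r'
  | .publish quorum => .publish (quorum.mono h)
  | .start entry own => .start (Entry.mono h _ _ entry) own
  | .read lt quorum => .read lt (quorum.mono h)
  | .join lt reads card card' => .join lt (reads.mono h) card card'
  | .low lt reads card => .low lt (reads.mono h) card
  | .high lt reads card => .high lt (reads.mono h) card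

theorem Next.slot_lt {K : Facts n X} {i : Fin n} {r r' : Query n X} (h : Next f i K r r') :
    slot n f r < slot n f r' := by
  cases h <;> grind [slot]

theorem Grants.slot_lt {K : Facts n X} {s j : Fin n} {r : Query n X} {φ : Datum n X}
    (h : Grants f s K j r φ) : slot n f r < 4 * depth f + 2 := by
  cases h <;> grind [slot]

theorem Next.eq_publish_or_slot_pos {K : Facts n X} {i : Fin n} {r r' : Query n X}
    (h : Next f i K r r') : r' = .publish ∨ 0 < slot n f r := by
  cases h with
  | publish => exact .inl rfl
  | start => exact .inr one_pos
  | read | join | low | high => exact .inr (by rw [slot]; omega)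

theorem Reads.exists_next {K : Facts n X} {i : Fin n} {g : Group} {V U : Value n X}
    (lt : g.length < depth f) (reads : Reads f K g V U) : ∃ r, Next f i K (.read g V) r := by
  by_cases hV : middle n f g ≤ V.card
  · exact ⟨_, .high lt reads hV⟩
  by_cases hU : middle n f g ≤ U.card
  · exact ⟨_, .join lt reads (not_le.1 hV) hU⟩
  · exact ⟨_, .low lt reads (not_le.1 hU)⟩

/-- What process `i` can prove with the facts in `K` when it asks a query. -/
def Supported (f : ℕ) (i : Fin n) (K : Facts n X) : Query n X → Prop
  | .certify => ∃ y, (i, .input y) ∈ K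
  | .publish => ∃ y, Quorum f K (.certified i y)
  | .write g V => g.length ≤ depth f ∧ Valid f K g V ∧ ∃ y, (i, y) ∈ V
  | .read g V => g.length < depth f ∧ Quorum f K (.wrote g V) ∧ ∃ y, (i, y) ∈ V

theorem Supported.mono {K K' : Facts n X} (h : K ⊆ K') {i : Fin n} {r : Query n X}
    (hr : Supported f i K r) : Supported f i K' r := by
  cases r with
  | certify => exact hr.imp fun y hy => h hy
  | publish => exact hr.imp fun y hy => hy.mono h
  | write => exact ⟨hr.1, hr.2.1.mono h, hr.2.2⟩
  | read => exact ⟨hr.1, hr.2.1.mono h, hr.2.2⟩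

theorem Supported.slot_lt {K : Facts n X} {i : Fin n} {r : Query n X}
    (h : Supported f i K r) : slot n f r < 4 * depth f + 5 := by
  cases r with
  | certify | publish => grind [slot]
  | write g V =>
    have := h.1
    grind [slot]
  | read g V =>
    have := h.1
    grind [slot]

theorem Supported.exists_leaf {K : Facts n X} {i : Fin n} {r : Query n X}
    (h : Supported f i K r) (hr : 4 * depth f + 2 ≤ slot n f r) :
    ∃ g V, r = .write g V ∧ g.length = depth f := by
  cases r with
  | certify | publish => grind [slot]
  | write g V =>
    have := h.1
    exact ⟨g, V, rfl, by grind [slot]⟩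
  | read g V =>
    have := h.1
    grind [slot]

theorem Next.supported {F : Finset (Fin n)} {x : Fin n → X} {G : ℕ → Facts n X}
    (R : Run f F x G) {K : Facts n X} (hK : K ⊆ total G) {i : Fin n} {r r' : Query n X}
    (h : Next f i K r r') (hr : Supported f i K r) : Supported f i K r' := by
  cases h with
  | publish quorum => exact ⟨_, quorum⟩
  | start entry own => exact ⟨Nat.zero_le _, .base entry, _, own⟩
  | read lt quorum => exact ⟨lt, quorum, hr.2.2⟩
  | join lt reads =>
    exact ⟨lt.le, reads.valid, hr.2.2.imp fun y hy => R.reads_subset (reads.mono hK) hy⟩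
  | low lt reads card => exact ⟨lt, .base ⟨_, reads, card⟩, hr.2.2⟩
  | high lt reads card =>
    exact ⟨lt, .base ⟨_, reads, card⟩, hr.2.2.imp fun y hy => R.reads_subset (reads.mono hK) hy⟩

/-- The state of a process: everything that it has received and signed, its current query, and the
queries that it has answered, each given by the process that asked and the slot. -/
structure LocalState (n : ℕ) (X : Type u) : Type u where
  bag : Msg n (Datum n X)
  query : Query n X
  answered : Finset (Fin n × ℕ)

/-- The signed facts in a message; signatures on anything but plain data are ignored. -/
def facts (m : Msg n (Datum n X)) : Facts n X := {a | (a.1, .data a.2) ∈ m.sigs}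

/-- The request `r`, together with everything that its sender knows. -/
def requestMsg (r : Query n X) (b : Msg n (Datum n X)) : Msg n (Datum n X) :=
  .pair (.data (.request r)) b

/-- The query in a request. -/
def asked : Msg n (Datum n X) → Option (Query n X)
  | .pair (.data (.request r)) _ => some r
  | _ => none

/-- Send a request to everybody, including the sender itself. -/
def broadcast (r : Query n X) (b : Msg n (Datum n X)) : List (Fin n × Msg n (Datum n X)) :=
  (List.finRange n).map fun d => (d, requestMsg r b)

/-- In state `st`, process `i` may sign `φ` as answer to the query `r` in the message `m` from
`j`. -/
structure CanAnswer (f : ℕ) (i : Fin n) (st : LocalState n X) (j : Fin n) (m : Msg n (Datum n X))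
    (r : Query n X) (φ : Datum n X) : Prop where
  asked : asked m = some r
  fresh : (j, slot n f r) ∉ st.answered
  grants : Grants f i (facts (st.bag.pair m)) j r φ

open Classical in
/-- Receive a message and answer the query in it, if possible. -/
noncomputable def serve (f : ℕ) (i : Fin n) (st : LocalState n X) (j : Fin n)
    (m : Msg n (Datum n X)) : LocalState n X × List (Fin n × Msg n (Datum n X)) :=
  if h : ∃ a : Query n X × Datum n X, CanAnswer f i st j m a.1 a.2 then
    let b := .pair (.sign i (.data h.choose.2)) (st.bag.pair m)
    (⟨b, st.query, insert (j, slot n f h.choose.1) st.answered⟩, [(j, b)])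
  else (⟨st.bag.pair m, st.query, st.answered⟩, [])

open Classical in
/-- Proceed to the next query, if possible. -/
noncomputable def advance (f : ℕ) (i : Fin n) (st : LocalState n X) :
    LocalState n X × List (Fin n × Msg n (Datum n X)) :=
  if h : ∃ r, Next f i (facts st.bag) st.query r then
    (⟨st.bag, h.choose, st.answered⟩, broadcast h.choose st.bag)
  else (st, [])

/-- The reaction to a message: answer it, then proceed. -/
noncomputable def react (f : ℕ) (i : Fin n) (st : LocalState n X) (j : Fin n)
    (m : Msg n (Datum n X)) : LocalState n X × List (Fin n × Msg n (Datum n X)) :=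
  ((advance f i (serve f i st j m).1).1,
    (serve f i st j m).2 ++ (advance f i (serve f i st j m).1).2)

/-- The join of the inputs in a nonempty value. -/
noncomputable def decision [SemilatticeSup X] (V : Value n X) : Option X :=
  open Classical in if h : V.Nonempty then some (V.sup' h Prod.snd) else none

/-- A process decides when it arrives in a leaf of the tree. -/
noncomputable def result [SemilatticeSup X] (f : ℕ) (st : LocalState n X) : Option X :=
  match st.query with
  | .write g V => if g.length = depth f then decision V else none
  | _ => none

/-- The initial state. -/
def initial (i : Fin n) (x : X) : LocalState n X := ⟨.sign i (.data (.input x)), .certify, ∅⟩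

/-- Lattice agreement by repeated halving of groups. -/
noncomputable abbrev protocol (n f : ℕ) (X : Type u) [SemilatticeSup X] : Protocol n X where
  State := LocalState n X
  Data := Datum n X
  start i x := (initial i x, broadcast .certify (initial i x).bag)
  step := react f
  output := result f

/-- The number of messages that a process may have sent in a state: one for each answer, and `n`
for each query. -/
def budget (n f : ℕ) (st : LocalState n X) : ℕ := st.answered.card + n * (slot n f st.query + 1)

section Messages

variable {a : Fin n × Datum n X}

theorem mem_facts_pair {m m' : Msg n (Datum n X)} :
    a ∈ facts (m.pair m') ↔ a ∈ facts m ∨ a ∈ facts m' :=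
  Iff.rfl

theorem mem_facts_sign {i : Fin n} {φ : Datum n X} :
    a ∈ facts (.sign i (.data φ)) ↔ a = (i, φ) := by
  simp [facts, Msg.sigs, Prod.ext_iff]

theorem sigs_requestMsg (r : Query n X) (b : Msg n (Datum n X)) :
    (requestMsg r b).sigs = b.sigs :=
  Set.empty_union _

theorem facts_requestMsg (r : Query n X) (b : Msg n (Datum n X)) :
    facts (requestMsg r b) = facts b := by
  simp only [facts, sigs_requestMsg]

theorem exists_mem_iff_wrote (m : Msg n (Datum n X)) (s : Fin n) (g : Group) :
    ∃ S : Finset (Value n X), ∀ W, W ∈ S ↔ (s, .wrote g W) ∈ facts m := by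
  have hfin : {W : Value n X | (s, .wrote g W) ∈ facts m}.Finite :=
    m.finite_sigs.preimage (f := fun W => (s, Msg.data (Datum.wrote g W)))
      fun W _ W' _ h => by simpa using h
  exact ⟨hfin.toFinset, fun W => hfin.mem_toFinset⟩

theorem Supported.exists_grants {m : Msg n (Datum n X)} {i : Fin n} {r : Query n X}
    (h : Supported f i (facts m) r) (hr : r ≠ .publish) (hslot : slot n f r < 4 * depth f + 2)
    (s : Fin n) : ∃ φ, Grants f s (facts m) i r φ := by
  cases r with
  | certify =>
    obtain ⟨y, hy⟩ := h
    exact ⟨_, .certify hy⟩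
  | publish => exact absurd rfl hr
  | write g V => exact ⟨_, .write (by grind [slot]) h.2.1⟩
  | read g V =>
    obtain ⟨S, hS⟩ := exists_mem_iff_wrote m s g
    exact ⟨_, .read h.1 h.2.1 hS⟩

theorem mem_broadcast {r : Query n X} {b : Msg n (Datum n X)} {o : Fin n × Msg n (Datum n X)} :
    o ∈ broadcast r b ↔ o.2 = requestMsg r b := by
  constructor
  · intro h
    obtain ⟨d, -, rfl⟩ := List.mem_map.1 h
    rfl
  · intro h
    exact List.mem_map.2 ⟨o.1, List.mem_finRange _, by rw [← h]⟩

theorem length_broadcast (r : Query n X) (b : Msg n (Datum n X)) :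
    (broadcast r b).length = n := by
  rw [broadcast, List.length_map, List.length_finRange]

end Messages

section Reactions

variable (f) (i : Fin n) (st : LocalState n X) (j : Fin n) (m : Msg n (Datum n X))

theorem serve_cases :
    (∀ r φ, ¬ CanAnswer f i st j m r φ) ∧
        serve f i st j m = (⟨st.bag.pair m, st.query, st.answered⟩, []) ∨
      ∃ r φ, CanAnswer f i st j m r φ ∧ serve f i st j m =
        (⟨.pair (.sign i (.data φ)) (st.bag.pair m), st.query, insert (j, slot n f r) st.answered⟩,
          [(j, .pair (.sign i (.data φ)) (st.bag.pair m))]) := by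
  by_cases h : ∃ a : Query n X × Datum n X, CanAnswer f i st j m a.1 a.2
  · refine .inr ⟨_, _, h.choose_spec, ?_⟩
    rw [serve, dif_pos h]
  · exact .inl ⟨fun r φ hr => h ⟨(r, φ), hr⟩, dif_neg h⟩

theorem advance_cases :
    (∀ r, ¬ Next f i (facts st.bag) st.query r) ∧ advance f i st = (st, []) ∨
      ∃ r, Next f i (facts st.bag) st.query r ∧
        advance f i st = (⟨st.bag, r, st.answered⟩, broadcast r st.bag) := by
  by_cases h : ∃ r, Next f i (facts st.bag) st.query r
  · exact .inr ⟨_, h.choose_spec, dif_pos h⟩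
  · exact .inl ⟨not_exists.1 h, dif_neg h⟩

theorem advance_bag : (advance f i st).1.bag = st.bag := by
  rcases advance_cases f i st with ⟨-, h⟩ | ⟨r, -, h⟩ <;> rw [h]

theorem advance_answered : (advance f i st).1.answered = st.answered := by
  rcases advance_cases f i st with ⟨-, h⟩ | ⟨r, -, h⟩ <;> rw [h]

theorem serve_query : (serve f i st j m).1.query = st.query := by
  rcases serve_cases f i st j m with ⟨-, h⟩ | ⟨r, φ, -, h⟩ <;> rw [h]

theorem react_bag : (react f i st j m).1.bag = (serve f i st j m).1.bag := advance_bag f i _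

theorem react_answered : (react f i st j m).1.answered = (serve f i st j m).1.answered :=
  advance_answered f i _

theorem react_answer_cases :
    (∀ r φ, ¬ CanAnswer f i st j m r φ) ∧ (react f i st j m).1.bag = st.bag.pair m ∧
        (react f i st j m).1.answered = st.answered ∨
      ∃ r φ, CanAnswer f i st j m r φ ∧
        (react f i st j m).1.bag = .pair (.sign i (.data φ)) (st.bag.pair m) ∧
        (react f i st j m).1.answered = insert (j, slot n f r) st.answered ∧
        (j, (react f i st j m).1.bag) ∈ (react f i st j m).2 := by
  rw [react_bag, react_answered, react]
  rcases serve_cases f i st j m with ⟨hno, h⟩ | ⟨r, φ, hr, h⟩ <;> rw [h]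
  · exact .inl ⟨hno, rfl, rfl⟩
  · exact .inr ⟨r, φ, hr, rfl, rfl, List.mem_append_left _ (List.mem_singleton_self _)⟩

theorem react_query_cases :
    (∀ r, ¬ Next f i (facts (react f i st j m).1.bag) st.query r) ∧
        (react f i st j m).1.query = st.query ∨
      Next f i (facts (react f i st j m).1.bag) st.query (react f i st j m).1.query ∧
        ∀ d, (d, requestMsg (react f i st j m).1.query (react f i st j m).1.bag) ∈
          (react f i st j m).2 := by
  rw [react_bag, react, ← serve_query f i st j m]
  rcases advance_cases f i (serve f i st j m).1 with ⟨hno, h⟩ | ⟨r, hr, h⟩ <;> rw [h]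
  · exact .inl ⟨hno, rfl⟩
  · exact .inr ⟨hr, fun d => List.mem_append_right _ (mem_broadcast.2 rfl)⟩

variable {f i st j m}

theorem mem_react {o : Fin n × Msg n (Datum n X)} (ho : o ∈ (react f i st j m).2) :
    o.2.sigs = (react f i st j m).1.bag.sigs ∧
      ∀ r, asked o.2 = some r → r = (react f i st j m).1.query := by
  rcases List.mem_append.1 ho with ho | ho
  · rw [react_bag]
    rcases serve_cases f i st j m with ⟨-, h⟩ | ⟨r, φ, -, h⟩ <;> rw [h] at ho ⊢
    · exact absurd ho List.not_mem_nil
    · obtain rfl := List.mem_singleton.1 ho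
      exact ⟨rfl, fun r hr => nomatch hr⟩
  · rw [react_bag, react]
    rcases advance_cases f i (serve f i st j m).1 with ⟨-, h⟩ | ⟨r, -, h⟩ <;> rw [h] at ho ⊢
    · exact absurd ho List.not_mem_nil
    · rw [mem_broadcast.1 ho]
      exact ⟨sigs_requestMsg _ _, fun r' hr' => (Option.some.inj hr').symm⟩

variable (f i st j m)

theorem length_react_add_budget_le :
    (react f i st j m).2.length + budget n f st ≤ budget n f (react f i st j m).1 := by
  have hserve : (serve f i st j m).2.length + budget n f st ≤ budget n f (serve f i st j m).1 := by
    rcases serve_cases f i st j m with ⟨-, h⟩ | ⟨r, φ, hr, h⟩ <;> rw [h]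
    · exact (Nat.zero_add _).le
    · simp only [budget, Finset.card_insert_of_notMem hr.fresh, List.length_singleton]
      omega
  have hadvance (st : LocalState n X) :
      (advance f i st).2.length + budget n f st ≤ budget n f (advance f i st).1 := by
    rcases advance_cases f i st with ⟨-, h⟩ | ⟨r, hr, h⟩ <;> rw [h]
    · exact (Nat.zero_add _).le
    · have := Nat.mul_le_mul_left n (Nat.succ_le_of_lt hr.slot_lt)
      simp only [budget, length_broadcast, Nat.succ_eq_add_one, mul_add, mul_one] at this ⊢
      omega
  have := hadvance (serve f i st j m).1
  simp only [react, List.length_append]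
  omega

theorem react_sigs_subset {s : Fin n × Msg n (Datum n X)}
    (hs : s ∈ (react f i st j m).1.bag.sigs) : s.1 = i ∨ s ∈ m.sigs ∨ s ∈ st.bag.sigs := by
  rcases react_answer_cases f i st j m with ⟨-, h, -⟩ | ⟨r, φ, -, h, -⟩ <;> rw [h] at hs
  · exact .inr hs.symm
  · rcases hs with hs | hs
    · exact .inl (congrArg Prod.fst (hs.resolve_right (Set.notMem_empty _)))
    · exact .inr hs.symm

theorem facts_subset_facts_react :
    facts (st.bag.pair m) ⊆ facts (react f i st j m).1.bag := by
  rcases react_answer_cases f i st j m with ⟨-, h, -⟩ | ⟨r, φ, -, h, -⟩ <;> rw [h]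
  exact fun _ => Or.inr

end Reactions

theorem isLUB_of_decision_eq_some [SemilatticeSup X] {V : Value n X} {y : X}
    (h : decision V = some y) : IsLUB (Prod.snd '' (V : Set (Fin n × X))) y := by
  classical
  by_cases hV : V.Nonempty
  · rw [decision, dif_pos hV, Option.some.injEq] at h
    subst h
    refine ⟨?_, fun u hu => Finset.sup'_le _ _ fun e he => hu ⟨e, he, rfl⟩⟩
    rintro _ ⟨e, he, rfl⟩
    exact Finset.le_sup' Prod.snd he
  · rw [decision, dif_neg hV] at h
    cases h

theorem result_of_leaf [SemilatticeSup X] {st : LocalState n X} {g : Group} {V : Value n X}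
    (h : st.query = .write g V) (hg : g.length = depth f) : result f st = decision V := by
  simp only [result, h, if_pos hg]

theorem exists_leaf_of_result_eq_some [SemilatticeSup X] {st : LocalState n X} {y : X}
    (h : result f st = some y) : ∃ g V, st.query = .write g V ∧ g.length = depth f := by
  unfold result at h
  split at h
  · next g V hq =>
    split_ifs at h with hg
    exact ⟨g, V, hq, hg⟩
  · cases h

theorem result_react [SemilatticeSup X] (i : Fin n) (st : LocalState n X) (j : Fin n)
    (m : Msg n (Datum n X)) (y : X) (h : result f st = some y) :
    result f (react f i st j m).1 = some y := by
  obtain ⟨g, V, hq, hg⟩ := exists_leaf_of_result_eq_some h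
  rcases react_query_cases f i st j m with ⟨-, hq'⟩ | ⟨hnext, -⟩
  · rwa [result_of_leaf (hq'.trans hq) hg, ← result_of_leaf hq hg]
  · rw [hq] at hnext
    generalize (react f i st j m).1.query = r at hnext
    cases hnext with
    | read lt => exact absurd hg lt.ne

theorem signsHonestly [SemilatticeSup X] (n f : ℕ) : (protocol n f X).SignsHonestly where
  start i x o ho s hs := by
    rw [mem_broadcast.1 ho, sigs_requestMsg] at hs
    exact congrArg Prod.fst (hs.resolve_right (Set.notMem_empty _))
  step i x h j m o ho s hs := by
    have bag_sigs : ∀ s ∈ (LocalState.bag ((protocol n f X).localState i x h)).sigs,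
        s.1 = i ∨ ∃ e ∈ h, s ∈ e.2.sigs := by
      clear ho hs
      induction h using List.reverseRecOn with
      | nil => exact fun s hs => .inl (congrArg Prod.fst (hs.resolve_right (Set.notMem_empty _)))
      | append_singleton h e ih =>
        intro s hs
        simp only [Protocol.localState, List.foldl_append, List.foldl_cons, List.foldl_nil] at hs ih
        rcases react_sigs_subset f i _ _ _ hs with hs | hs | hs
        · exact .inl hs
        · exact .inr ⟨e, by simp, hs⟩
        · exact (ih s hs).imp_right fun ⟨e', he', hs⟩ => ⟨e', by simp [he'], hs⟩
    rw [(mem_react ho).1] at hs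
    rcases react_sigs_subset f i _ _ _ hs with hs | hs | hs
    · exact .inl hs
    · exact .inr (.inl hs)
    · exact (bag_sigs s hs).imp_right .inr

section Knowledge

variable [SemilatticeSup X] {F : Finset (Fin n)} {x : Fin n → X}
  (E : Execution (protocol n f X) F x)

/-- The state of process `i` in the `k`-th configuration. -/
abbrev stateAt (k : ℕ) (i : Fin n) : LocalState n X := (E.conf k).state i

/-- The facts that process `i` knows in the `k`-th configuration. -/
def known (k : ℕ) (i : Fin n) : Facts n X := facts (stateAt E k i).bag

/-- The facts that may occur in messages in the `k`-th configuration: those that are known to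
their correct signer, and all those that are ascribed to a Byzantine process. -/
def issued (k : ℕ) : Facts n X := {a | a.1 ∈ F ∨ a ∈ known E k a.1}

/-- In the step after the `a`-th configuration, process `i` signs `φ` as answer to the query `r` in
the message `m` from `j`. -/
structure Signs (a : ℕ) (i j : Fin n) (m : Msg n (Datum n X)) (r : Query n X) (φ : Datum n X) :
    Prop where
  receives : Receives F (E.conf a) (E.conf (a + 1)) i j m
  canAnswer : CanAnswer f i (stateAt E a i) j m r φ
  bag_eq : (stateAt E (a + 1) i).bag = .pair (.sign i (.data φ)) ((stateAt E a i).bag.pair m)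
  answered_eq : (stateAt E (a + 1) i).answered =
    insert (j, slot n f r) (stateAt E a i).answered
  reply : ⟨i, j, (stateAt E (a + 1) i).bag⟩ ∈ (E.conf (a + 1)).sent

theorem known_mono (i : Fin n) : Monotone fun k => known E k i :=
  E.state_mono (fun st => facts (LocalState.bag st)) fun st j m =>
    subset_trans (fun _ => Or.inl) (facts_subset_facts_react f i st j m)

theorem issued_mono : Monotone (issued E) :=
  fun _ _ h _ => Or.imp_right fun ha => known_mono E _ h ha

theorem answered_mono (i : Fin n) : Monotone fun k => (stateAt E k i).answered := by
  refine E.state_mono LocalState.answered fun st j m => ?_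
  rcases react_answer_cases f i st j m with ⟨-, -, h⟩ | ⟨r, φ, -, -, h, -⟩
  · exact h.ge
  · exact (Finset.subset_insert _ _).trans h.ge

theorem known_zero (i : Fin n) : known E 0 i = {(i, .input (x i))} := by
  ext a
  rw [known, stateAt, E.state_zero]
  exact mem_facts_sign

variable {E} {a k : ℕ} {i j : Fin n} {m : Msg n (Datum n X)}

theorem sent_spec {e : Envelope n (Datum n X)} (he : e ∈ (E.conf k).sent) :
    ∃ k' ≤ k, e.msg.sigs = (stateAt E k' e.src).bag.sigs ∧
      ∀ r, asked e.msg = some r → r = (stateAt E k' e.src).query := by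
  refine E.exists_state_of_mem_sent (Φ := fun _ st o => o.2.sigs = (LocalState.bag st).sigs ∧
    ∀ r, asked o.2 = some r → r = LocalState.query st) ?_ (fun i st j m o => mem_react) he
  intro i y o ho
  rw [mem_broadcast.1 ho]
  exact ⟨sigs_requestMsg _ _, fun r hr => (Option.some.inj hr).symm⟩

theorem facts_subset_known {e : Envelope n (Datum n X)} (he : e ∈ (E.conf k).sent) :
    facts e.msg ⊆ known E k e.src := by
  obtain ⟨k', hk, hsigs, -⟩ := sent_spec he
  intro a ha
  rw [facts, Set.mem_ofPred_eq, hsigs] at ha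
  exact known_mono E e.src hk ha

theorem exists_mem_known_of_receives {c : Config (protocol n f X)}
    (h : Receives F (E.conf k) c i j m) {b : Fin n × Datum n X} (hb : b ∈ facts m) :
    b.1 ∈ F ∨ ∃ s ∉ F, b ∈ known E k s := by
  rcases h.origin with he | ⟨-, hsigs⟩
  · exact .inr ⟨j, E.src_notMem he, facts_subset_known he hb⟩
  · refine or_iff_not_imp_left.2 fun hbF => ?_
    obtain ⟨e, he, -, hbe⟩ := hsigs _ hb hbF
    exact ⟨e.src, E.src_notMem he, facts_subset_known he hbe⟩

variable (E k) in
theorem known_subset_issued (hi : i ∉ F) : known E k i ⊆ issued E k := by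
  induction k generalizing i with
  | zero =>
    rw [known_zero]
    rintro _ rfl
    exact .inr ((known_zero E i).ge rfl)
  | succ k ih =>
    intro b hb
    rcases (E.step k).exists_receives_or_pending i with ⟨j, m, h⟩ | ⟨h, -⟩
    · have hb' := hb
      rw [known, stateAt, h.state_self] at hb'
      rcases react_sigs_subset f i _ _ _ hb' with hbi | hb' | hb'
      · obtain rfl : b.1 = i := hbi
        exact .inr hb
      · rcases exists_mem_known_of_receives h hb' with hbF | ⟨s, hs, hbs⟩
        · exact .inl hbF
        · exact issued_mono E k.le_succ (ih hs hbs)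
      · exact issued_mono E k.le_succ (ih hi hb')
    · rw [known, stateAt, h] at hb
      exact issued_mono E k.le_succ (ih hi hb)

theorem facts_pair_subset_issued {c : Config (protocol n f X)}
    (h : Receives F (E.conf k) c i j m) :
    facts ((stateAt E k i).bag.pair m) ⊆ issued E k := by
  rintro b (hb | hb)
  · exact known_subset_issued E k h.correct hb
  · rcases exists_mem_known_of_receives h hb with hbF | ⟨s, hs, hbs⟩
    · exact .inl hbF
    · exact known_subset_issued E k hs hbs

theorem signs_or_silent (h : Receives F (E.conf a) (E.conf (a + 1)) i j m) :
    (∃ r φ, Signs E a i j m r φ) ∨ (∀ r φ, ¬ CanAnswer f i (stateAt E a i) j m r φ) ∧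
      (stateAt E (a + 1) i).bag = (stateAt E a i).bag.pair m ∧
      (stateAt E (a + 1) i).answered = (stateAt E a i).answered := by
  have hstate : stateAt E (a + 1) i = (react f i (stateAt E a i) j m).1 := h.state_self
  rcases react_answer_cases f i (stateAt E a i) j m with hno | ⟨r, φ, hr, hbag, hans, hreply⟩
  · exact .inr (hstate ▸ hno)
  · refine .inl ⟨r, φ, h, hr, hstate ▸ hbag, hstate ▸ hans, ?_⟩
    rw [h.sent, hstate]
    exact List.mem_append_right _ (mem_envelopes.2 ⟨rfl, hreply⟩)

theorem Signs.mem_known {r : Query n X} {φ : Datum n X} (h : Signs E a i j m r φ) :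
    (i, φ) ∈ known E (a + 1) i := by
  rw [known, h.bag_eq]
  exact .inl (mem_facts_sign.2 rfl)

theorem Signs.facts_subset_known {r : Query n X} {φ : Datum n X} (h : Signs E a i j m r φ) :
    facts ((stateAt E a i).bag.pair m) ⊆ known E (a + 1) i := by
  rw [known, h.bag_eq]
  exact fun _ => .inr

theorem exists_signs_of_mem_known {φ : Datum n X} (hi : i ∉ F) (h : (i, φ) ∈ known E k i) :
    φ = .input (x i) ∨ ∃ a < k, ∃ j m r, Signs E a i j m r φ := by
  induction k with
  | zero => exact .inl (congrArg Prod.snd ((known_zero E i).le h))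
  | succ k ih =>
    have old (h : (i, φ) ∈ issued E k) :
        φ = .input (x i) ∨ ∃ a < k + 1, ∃ j m r, Signs E a i j m r φ :=
      (ih (h.resolve_left hi)).imp_right fun ⟨a, ha, hs⟩ => ⟨a, ha.trans k.lt_succ_self, hs⟩
    rcases (E.step k).exists_receives_or_pending i with ⟨j, m, hr⟩ | ⟨hst, -⟩
    · have hold := facts_pair_subset_issued hr
      rcases signs_or_silent hr with ⟨r, ψ, hs⟩ | ⟨-, hbag, -⟩
      · rw [known, hs.bag_eq] at h
        rcases mem_facts_pair.1 h with h | h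
        · obtain rfl : φ = ψ := congrArg Prod.snd (mem_facts_sign.1 h)
          exact .inr ⟨k, k.lt_succ_self, j, m, r, hs⟩
        · exact old (hold h)
      · rw [known, hbag] at h
        exact old (hold h)
    · rw [known, stateAt, hst] at h
      exact old (.inr h)

theorem exists_signs_of_mem_answered {p : ℕ} (h : (j, p) ∈ (stateAt E k i).answered) :
    ∃ a < k, ∃ m r φ, Signs E a i j m r φ ∧ slot n f r = p := by
  induction k with
  | zero =>
    rw [stateAt, E.state_zero] at h
    exact absurd h (Finset.notMem_empty _)
  | succ k ih =>
    have old (h : (j, p) ∈ (stateAt E k i).answered) :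
        ∃ a < k + 1, ∃ m r φ, Signs E a i j m r φ ∧ slot n f r = p :=
      (ih h).imp fun a ha => ⟨ha.1.trans k.lt_succ_self, ha.2⟩
    rcases (E.step k).exists_receives_or_pending i with ⟨j', m, hr⟩ | ⟨hst, -⟩
    · rcases signs_or_silent hr with ⟨r, φ, hs⟩ | ⟨-, -, hans⟩
      · rw [hs.answered_eq, Finset.mem_insert] at h
        rcases h with h | h
        · obtain ⟨rfl, rfl⟩ := Prod.mk.inj h
          exact ⟨k, k.lt_succ_self, m, r, φ, hs, rfl⟩
        · exact old h
      · exact old (hans ▸ h)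
    · rw [stateAt, hst] at h
      exact old h

theorem Signs.time_le {a' : ℕ} {m' : Msg n (Datum n X)} {r r' : Query n X} {φ φ' : Datum n X}
    (h : Signs E a i j m r φ) (h' : Signs E a' i j m' r' φ') (hr : slot n f r = slot n f r') :
    a' ≤ a := by
  by_contra! hlt
  refine h'.canAnswer.fresh (answered_mono E i hlt ?_)
  simp only [h.answered_eq, hr, Finset.mem_insert_self]

theorem Signs.unique {a' : ℕ} {m' : Msg n (Datum n X)} {r r' : Query n X} {φ φ' : Datum n X}
    (h : Signs E a i j m r φ) (h' : Signs E a' i j m' r' φ') (hr : slot n f r = slot n f r') :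
    φ = φ' := by
  obtain rfl : a = a' := le_antisymm (h'.time_le h hr.symm) (h.time_le h' hr)
  have := h.bag_eq.symm.trans h'.bag_eq
  simp only [Msg.pair.injEq, Msg.sign.injEq, Msg.data.injEq] at this
  exact this.1.2

variable (E) in
theorem run (hf : 3 * f < n) (hF : F.card ≤ f) : Run f F x (issued E) where
  resilient := hf
  faulty_card := hF
  mono := issued_mono E
  input_eq k s hs y h := by
    rcases exists_signs_of_mem_known hs (h.resolve_left hs) with h | ⟨a, -, j, m, r, h⟩
    · exact Datum.input.inj h
    · exact nomatch h.canAnswer.grants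
  input_mem k s hs j y h := by
    rcases exists_signs_of_mem_known hs (h.resolve_left hs) with h | ⟨a, ha, i, m, r, h⟩
    · exact nomatch h
    · cases h.canAnswer.grants with
      | certify mem => exact issued_mono E ha.le (facts_pair_subset_issued h.receives mem)
  certified_unique k s hs j y z h h' := by
    rcases exists_signs_of_mem_known hs (h.resolve_left hs) with h | ⟨a, -, i, m, r, h⟩
    · exact nomatch h
    rcases exists_signs_of_mem_known hs (h'.resolve_left hs) with h' | ⟨a', -, i', m', r', h'⟩
    · exact nomatch h'
    cases h.canAnswer.grants with
    | certify => cases h'.canAnswer.grants with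
      | certify => exact (Datum.certified.inj (h.unique h' rfl)).2
  wrote_valid k s hs g V h := by
    rcases exists_signs_of_mem_known hs (h.resolve_left hs) with h | ⟨a, ha, i, m, r, h⟩
    · exact nomatch h
    · cases h.canAnswer.grants with
      | write lt valid =>
        exact valid.mono ((facts_pair_subset_issued h.receives).trans (issued_mono E ha.le))
  saw_after k s hs g V S h := by
    rcases exists_signs_of_mem_known hs (h.resolve_left hs) with h | ⟨a, -, i, m, r, h⟩
    · exact nomatch h
    · cases h.canAnswer.grants with
      | read lt quorum mem_iff =>
        exact ⟨a, quorum.mono (facts_pair_subset_issued h.receives), fun W hW =>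
          (mem_iff W).2 (.inl (hW.resolve_left hs))⟩

theorem query_step (E : Execution (protocol n f X) F x) (k : ℕ) (i : Fin n) :
    (stateAt E (k + 1) i).query = (stateAt E k i).query ∨
      Next f i (known E (k + 1) i) (stateAt E k i).query (stateAt E (k + 1) i).query ∧
        ∀ d, ⟨i, d, requestMsg (stateAt E (k + 1) i).query (stateAt E (k + 1) i).bag⟩ ∈
          (E.conf (k + 1)).sent := by
  rcases (E.step k).exists_receives_or_pending i with ⟨j, m, h⟩ | ⟨h, -⟩
  · have hstate : stateAt E (k + 1) i = (react f i (stateAt E k i) j m).1 := h.state_self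
    rw [known, hstate]
    refine (react_query_cases f i (stateAt E k i) j m).imp And.right fun hnext => ⟨hnext.1, ?_⟩
    intro d
    rw [h.sent]
    exact List.mem_append_right _ (mem_envelopes.2 ⟨rfl, hnext.2 d⟩)
  · exact .inl (congrArg LocalState.query h)

theorem query_eq_or_slot_lt (E : Execution (protocol n f X) F x) {k k' : ℕ} (hk : k ≤ k')
    (i : Fin n) : (stateAt E k' i).query = (stateAt E k i).query ∨
      slot n f (stateAt E k i).query < slot n f (stateAt E k' i).query := by
  induction hk with
  | refl => exact .inl rfl
  | @step k' _ ih =>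
    rcases query_step E k' i with h | ⟨h, -⟩
    · rwa [h]
    · rcases ih with h' | h'
      · exact .inr (h' ▸ h.slot_lt)
      · exact .inr (h'.trans h.slot_lt)

theorem slot_mono (E : Execution (protocol n f X) F x) (i : Fin n) :
    Monotone fun k => slot n f (stateAt E k i).query := fun _ _ hk =>
  (query_eq_or_slot_lt E hk i).elim (fun h => (congrArg (slot n f) h).ge) le_of_lt

theorem query_eq_of_slot_eq {k k' : ℕ}
    (h : slot n f (stateAt E k i).query = slot n f (stateAt E k' i).query) :
    (stateAt E k i).query = (stateAt E k' i).query := by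
  rcases le_total k k' with hk | hk
  · exact ((query_eq_or_slot_lt E hk i).resolve_right h.not_lt).symm
  · exact (query_eq_or_slot_lt E hk i).resolve_right h.symm.not_lt

theorem exists_sent_request (E : Execution (protocol n f X) F x) (hi : i ∉ F) (k : ℕ) :
    ∃ k' ≤ k, (stateAt E k' i).query = (stateAt E k i).query ∧
      ∀ d, ⟨i, d, requestMsg (stateAt E k' i).query (stateAt E k' i).bag⟩ ∈ (E.conf k').sent := by
  induction k with
  | zero =>
    refine ⟨0, le_rfl, rfl, fun d => E.mem_sent_zero.2 ⟨hi, ?_⟩⟩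
    rw [stateAt, E.state_zero]
    exact mem_broadcast.2 rfl
  | succ k ih =>
    rcases query_step E k i with h | ⟨-, h⟩
    · obtain ⟨k', hk, hq, hsent⟩ := ih
      exact ⟨k', hk.trans k.le_succ, hq.trans h.symm, hsent⟩
    · exact ⟨k + 1, le_rfl, rfl, h⟩

theorem exists_query_eq_publish (h : 0 < slot n f (stateAt E k i).query) :
    ∃ k' ≤ k, (stateAt E k' i).query = .publish := by
  induction k with
  | zero =>
    rw [stateAt, E.state_zero] at h
    exact absurd h (lt_irrefl 0)
  | succ k ih =>
    have old (h : 0 < slot n f (stateAt E k i).query) :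
        ∃ k' ≤ k + 1, (stateAt E k' i).query = .publish :=
      (ih h).imp fun k' hk => ⟨hk.1.trans k.le_succ, hk.2⟩
    rcases query_step E k i with h' | ⟨h', -⟩
    · exact old (h' ▸ h)
    · rcases h'.eq_publish_or_slot_pos with h' | h'
      · exact ⟨k + 1, le_rfl, h'⟩
      · exact old h'

theorem query_supported (R : Run f F x (issued E)) (hi : i ∉ F) (k : ℕ) :
    Supported f i (known E k i) (stateAt E k i).query := by
  induction k with
  | zero =>
    rw [known_zero, stateAt, E.state_zero]
    exact ⟨x i, rfl⟩
  | succ k ih =>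
    have ih' := ih.mono (known_mono E i k.le_succ)
    rcases query_step E k i with h | ⟨h, -⟩
    · rwa [h]
    · exact h.supported R ((known_subset_issued E _ hi).trans (subset_total _ _)) ih'

end Knowledge

section Liveness

variable [SemilatticeSup X] {F : Finset (Fin n)} {x : Fin n → X}

/-- In `K`, there is an answer of process `s` to the query `r` of process `i`, together with
everything that `s` knew when it signed the answer. -/
def HasAnswer (E : Execution (protocol n f X) F x) (K : Facts n X) (i s : Fin n)
    (r : Query n X) : Prop :=
  ∃ a m φ, Signs E a s i m r φ ∧ known E (a + 1) s ⊆ K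

variable {E : Execution (protocol n f X) F x} {τ : ℕ → ℝ} {a k : ℕ} {i j s : Fin n}
  {m : Msg n (Datum n X)} {r : Query n X} {K : Facts n X}

theorem HasAnswer.mono {K' : Facts n X} (h : K ⊆ K') :
    HasAnswer E K i s r → HasAnswer E K' i s r :=
  fun ⟨a, m, φ, hs, hK⟩ => ⟨a, m, φ, hs, hK.trans h⟩

theorem receives_facts_subset_known (h : Receives F (E.conf a) (E.conf (a + 1)) i j m) :
    facts m ⊆ known E (a + 1) i := by
  intro b hb
  rw [known, stateAt, h.state_self]
  exact facts_subset_facts_react f i _ j m (mem_facts_pair.2 (.inr hb))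

theorem valid_of_mem_known {g : Group} {W : Value n X} (hs : s ∉ F)
    (h : (s, .wrote g W) ∈ known E k s) : Valid f (known E k s) g W := by
  rcases exists_signs_of_mem_known hs h with h | ⟨a, ha, j, m, r, h⟩
  · exact nomatch h
  · cases h.canAnswer.grants with
    | write lt valid =>
      exact valid.mono (h.facts_subset_known.trans (known_mono E s ha))

theorem exists_signs (R : Run f F x (issued E)) (T : E.IsRoundTiming τ) (hi : i ∉ F) (hs : s ∉ F)
    (hpub : (stateAt E k i).query ≠ .publish)
    (hslot : slot n f (stateAt E k i).query < 4 * depth f + 2) :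
    ∃ a m φ, τ (a + 1) ≤ τ k + 1 ∧ Signs E a s i m (stateAt E k i).query φ := by
  obtain ⟨k', hk, hq, hsent⟩ := exists_sent_request E hi k
  rw [← hq] at hpub hslot ⊢
  obtain ⟨a, ha, hrec⟩ := T.exists_receives_of_mem (hsent s) hs
  replace ha : τ (a + 1) ≤ τ k + 1 := ha.trans (add_le_add_left (T.mono hk) 1)
  rcases signs_or_silent hrec with ⟨r, φ, h⟩ | ⟨hno, -⟩
  · obtain rfl := Option.some.inj h.canAnswer.asked
    exact ⟨a, _, φ, ha, h⟩
  have hsupp : Supported f i (facts ((stateAt E a s).bag.pair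
      (requestMsg (stateAt E k' i).query (stateAt E k' i).bag))) (stateAt E k' i).query := by
    refine (query_supported R hi k').mono fun b hb => mem_facts_pair.2 (.inr ?_)
    rwa [facts_requestMsg]
  obtain ⟨φ, hφ⟩ := hsupp.exists_grants hpub hslot s
  -- the request can only be refused because the query has been answered before
  have hans : (i, slot n f (stateAt E k' i).query) ∈ (stateAt E a s).answered :=
    by_contra fun hfresh => hno _ φ ⟨rfl, hfresh, hφ⟩
  obtain ⟨a', ha', m, r, φ, h, hr⟩ := exists_signs_of_mem_answered hans
  obtain ⟨k'', -, -, hasked⟩ :=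
    sent_spec (h.receives.origin.resolve_right fun hF => hi hF.1)
  obtain rfl := (hasked r h.canAnswer.asked).trans
    (query_eq_of_slot_eq ((congrArg _ (hasked r h.canAnswer.asked)).symm.trans hr))
  exact ⟨a', m, φ, (T.mono (Nat.succ_le_succ ha'.le)).trans ha, h⟩

theorem exists_hasAnswer (R : Run f F x (issued E)) (T : E.IsRoundTiming τ) (hi : i ∉ F)
    (hs : s ∉ F) (hpub : (stateAt E k i).query ≠ .publish)
    (hslot : slot n f (stateAt E k i).query < 4 * depth f + 2) :
    ∃ k', τ k' ≤ τ k + 2 ∧ HasAnswer E (known E k' i) i s (stateAt E k i).query := by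
  obtain ⟨a, m, φ, ha, h⟩ := exists_signs R T hi hs hpub hslot
  obtain ⟨a', ha', hrec⟩ := T.exists_receives_of_mem h.reply hi
  exact ⟨a' + 1, by linarith, a, m, φ, h, receives_facts_subset_known hrec⟩

theorem exists_next_of_hasAnswer (R : Run f F x (issued E)) (hi : i ∉ F)
    (hpub : r ≠ .publish) (hslot : slot n f r < 4 * depth f + 2)
    (h : ∀ s ∉ F, HasAnswer E K i s r) : ∃ r', Next f i K r r' := by
  cases r with
  | certify =>
    refine ⟨_, .publish (y := x i) ⟨Fᶜ, R.le_card_compl, fun s hs => ?_⟩⟩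
    obtain ⟨a, m, φ, hsign, hK⟩ := h s (Finset.mem_compl.1 hs)
    have hmem := hK hsign.mem_known
    cases hsign.canAnswer.grants with
    | certify mem =>
      rwa [R.input_eq a i hi _ (facts_pair_subset_issued hsign.receives mem)] at hmem
  | publish => exact absurd rfl hpub
  | write g V =>
    refine ⟨_, .read (by grind [slot]) ⟨Fᶜ, R.le_card_compl, fun s hs => ?_⟩⟩
    obtain ⟨a, m, φ, hsign, hK⟩ := h s (Finset.mem_compl.1 hs)
    have hmem := hK hsign.mem_known
    cases hsign.canAnswer.grants with
    | write => exact hmem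
  | read g V =>
    have hsaw : ∀ s ∉ F, ∃ S, (s, .saw g V S) ∈ K ∧ ∀ W ∈ S, Valid f K g W := by
      intro s hs
      obtain ⟨a, m, φ, hsign, hK⟩ := h s hs
      have hmem := hK hsign.mem_known
      cases hsign.canAnswer.grants with
      | @read _ _ S lt quorum mem_iff =>
        exact ⟨S, hmem, fun W hW =>
          (valid_of_mem_known hs (hsign.facts_subset_known ((mem_iff W).1 hW))).mono hK⟩
    choose! S hS hval using hsaw
    refine Reads.exists_next (by grind [slot]) ⟨Fᶜ, S, ⟨R.le_card_compl, ?_⟩, ?_, rfl⟩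
    · exact fun s hs => hS s (Finset.mem_compl.1 hs)
    · exact fun s hs => hval s (Finset.mem_compl.1 hs)

theorem exists_next_of_certified (R : Run f F x (issued E)) (hi : i ∉ F)
    (h : ∀ j ∉ F, ∃ y, Quorum f K (.certified j y)) : ∃ r, Next f i K .publish r := by
  classical
  have : Nonempty X := ⟨x i⟩
  choose! y hy using h
  refine ⟨_, .start (V := Fᶜ.image fun j => (j, y j)) (y := y i) ⟨?_, ?_⟩ ?_⟩
  · intro e he
    obtain ⟨j, hj, rfl⟩ := Finset.mem_image.1 he
    exact hy j (Finset.mem_compl.1 hj)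
  · rw [Finset.card_image_of_injective _ fun j j' h => congrArg Prod.fst h]
    exact R.le_card_compl
  · exact Finset.mem_image_of_mem _ (Finset.mem_compl.2 hi)

theorem exists_certified (R : Run f F x (issued E)) (T : E.IsRoundTiming τ) (hi : i ∉ F)
    (hj : j ∉ F) (h : 0 < slot n f (stateAt E k j).query) :
    ∃ k', τ k' ≤ τ k + 1 ∧ ∃ y, Quorum f (known E k' i) (.certified j y) := by
  obtain ⟨k₁, hk₁, hq₁⟩ := exists_query_eq_publish h
  obtain ⟨k₂, hk₂, hq₂, hsent⟩ := exists_sent_request E hj k₁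
  obtain ⟨a, ha, hrec⟩ := T.exists_receives_of_mem (hsent i) hi
  have hsupp := query_supported R hj k₂
  rw [hq₂, hq₁, known, ← facts_requestMsg (stateAt E k₂ j).query] at hsupp
  obtain ⟨y, hy⟩ := hsupp
  exact ⟨a + 1, ha.trans (add_le_add_left (T.mono (hk₂.trans hk₁)) 1), y,
    hy.mono (receives_facts_subset_known hrec)⟩

theorem exists_next (R : Run f F x (issued E)) (T : E.IsRoundTiming τ) (hi : i ∉ F)
    (hpos : 0 ≤ τ k)
    (hall : ∀ j ∉ F, slot n f (stateAt E k i).query ≤ slot n f (stateAt E k j).query)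
    (hslot : slot n f (stateAt E k i).query < 4 * depth f + 2) :
    ∃ k', τ k' ≤ τ k + 2 ∧ ∃ r, Next f i (known E k' i) (stateAt E k i).query r := by
  by_cases hpub : (stateAt E k i).query = .publish
  · rw [hpub] at hall ⊢
    obtain ⟨k', hk', h⟩ := T.exists_forall Fᶜ
      (p := fun j k' => ∃ y, Quorum f (known E k' i) (.certified j y)) (t := τ k + 1)
      (fun j _ k₁ k₂ hk => Exists.imp fun y hy => hy.mono (known_mono E i hk)) (by linarith)
      fun j hj => exists_certified R T hi (Finset.mem_compl.1 hj)
        (hall j (Finset.mem_compl.1 hj))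
    exact ⟨k', by linarith, exists_next_of_certified R hi fun j hj =>
      h j (Finset.mem_compl.2 hj)⟩
  · obtain ⟨k', hk', h⟩ := T.exists_forall Fᶜ
      (p := fun s k' => HasAnswer E (known E k' i) i s (stateAt E k i).query)
      (fun s _ k₁ k₂ hk => HasAnswer.mono (known_mono E i hk)) (by linarith)
      fun s hs => exists_hasAnswer R T hi (Finset.mem_compl.1 hs) hpub hslot
    exact ⟨k', hk', exists_next_of_hasAnswer R hi hpub hslot fun s hs =>
      h s (Finset.mem_compl.2 hs)⟩

theorem pending_or_forall_not_next (E : Execution (protocol n f X) F x) (hi : i ∉ F) (k : ℕ) :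
    (E.conf k).Pending i ∨ ∀ r, ¬ Next f i (known E k i) (stateAt E k i).query r := by
  induction k with
  | zero =>
    obtain ⟨id, hid⟩ := List.mem_iff_getElem?.1 ((E.mem_sent_zero
      (e := ⟨i, i, requestMsg .certify (initial i (x i)).bag⟩)).2 ⟨hi, mem_broadcast.2 rfl⟩)
    exact .inl ⟨id, _, hid, rfl, E.delivered_zero ▸ Set.notMem_empty id⟩
  | succ k ih =>
    rcases (E.step k).exists_receives_or_pending i with ⟨j, m, h⟩ | ⟨hst, hpend⟩
    · rw [known, stateAt, h.state_self]
      rcases react_query_cases f i (stateAt E k i) j m with ⟨hno, hq⟩ | ⟨-, hsent⟩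
      · exact .inr (hq ▸ hno)
      · exact .inl (E.pending_of_mem h (hsent i))
    · rw [known, stateAt, hst]
      exact ih.imp_left hpend

theorem exists_slot_lt (T : E.IsRoundTiming τ) (hi : i ∉ F)
    (h : Next f i (known E k i) (stateAt E k i).query r) :
    ∃ k', τ k' ≤ τ k + 1 ∧ slot n f (stateAt E k i).query < slot n f (stateAt E k' i).query := by
  obtain ⟨a, hka, ha, j, m, hrec⟩ := T.exists_receives_of_pending
    ((pending_or_forall_not_next E hi k).resolve_right fun hno => hno r h) hi
  rcases query_eq_or_slot_lt E hka i with hq | hlt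
  · refine ⟨a + 1, ha, hq ▸ ?_⟩
    replace h : Next f i (known E (a + 1) i) (stateAt E k i).query r :=
      h.mono (known_mono E i (hka.trans a.le_succ))
    have hstate : stateAt E (a + 1) i = (react f i (stateAt E a i) j m).1 := hrec.state_self
    rw [known, hstate, ← hq] at h
    rw [hstate]
    rcases react_query_cases f i (stateAt E a i) j m with ⟨hno, -⟩ | ⟨hnext, -⟩
    · exact absurd h (hno r)
    · exact hnext.slot_lt
  · exact ⟨a, (T.mono a.le_succ).trans ha, hlt⟩

theorem exists_slot_lt_of_forall_le (R : Run f F x (issued E)) (T : E.IsRoundTiming τ)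
    (hi : i ∉ F) (hpos : 0 ≤ τ k)
    (hall : ∀ j ∉ F, slot n f (stateAt E k i).query ≤ slot n f (stateAt E k j).query)
    (hslot : slot n f (stateAt E k i).query < 4 * depth f + 2) :
    ∃ k', τ k' ≤ τ k + 3 ∧ slot n f (stateAt E k i).query < slot n f (stateAt E k' i).query := by
  obtain ⟨k', hk', r, h⟩ := exists_next R T hi hpos hall hslot
  have hmax : τ (max k k') ≤ τ k + 2 := by
    rcases max_choice k k' with hm | hm <;> rw [hm] <;> linarith
  rcases query_eq_or_slot_lt E (le_max_left k k') i with hq | hlt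
  · obtain ⟨k'', hk'', hlt⟩ := exists_slot_lt T hi
      (hq ▸ h.mono (known_mono E i (le_max_right k k')))
    exact ⟨k'', by linarith, hq ▸ hlt⟩
  · exact ⟨_, by linarith, hlt⟩

theorem exists_forall_le_slot (R : Run f F x (issued E)) (T : E.IsRoundTiming τ) {p : ℕ}
    (hp : p ≤ 4 * depth f + 2) :
    ∃ k, τ k ≤ 3 * p ∧ ∀ i ∈ Fᶜ, p ≤ slot n f (stateAt E k i).query := by
  induction p with
  | zero => exact ⟨0, by simp [T.zero], fun i _ => Nat.zero_le _⟩
  | succ p ih =>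
    obtain ⟨k, hk, hall⟩ := ih (by omega)
    refine T.exists_forall Fᶜ
      (fun i _ k₁ k₂ hk₁ (h : p + 1 ≤ _) => h.trans (slot_mono E i hk₁)) (by positivity) ?_
    intro i hi
    push_cast
    rcases (hall i hi).eq_or_lt with heq | hlt
    · obtain ⟨k', hk', h⟩ := exists_slot_lt_of_forall_le R T (Finset.mem_compl.1 hi)
        (T.zero.ge.trans (T.mono k.zero_le))
        (fun j hj => heq ▸ hall j (Finset.mem_compl.2 hj)) (by omega)
      exact ⟨k', by linarith, by omega⟩
    · exact ⟨k, by linarith, hlt⟩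

theorem exists_leaf (R : Run f F x (issued E)) (T : E.IsRoundTiming τ) (hi : i ∉ F) :
    ∃ k, τ k ≤ (3 * (4 * depth f + 2) : ℕ) ∧ ∃ g V, (stateAt E k i).query = .write g V ∧
      g.length = depth f ∧ Valid f (total (issued E)) g V ∧ (i, x i) ∈ V := by
  obtain ⟨k, hk, hall⟩ := exists_forall_le_slot R T le_rfl
  refine ⟨k, by exact_mod_cast hk, ?_⟩
  have hsupp := query_supported R hi k
  obtain ⟨g, V, hq, hg⟩ := hsupp.exists_leaf (hall i (Finset.mem_compl.2 hi))
  rw [hq] at hsupp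
  obtain ⟨-, hvalid, y, hy⟩ := hsupp
  replace hvalid := hvalid.mono ((known_subset_issued E k hi).trans (subset_total _ k))
  have hyx : y = x i := R.eq_input_of_mem_certifiedSet (R.coe_subset_certifiedSet hvalid hy) hi
  exact ⟨g, V, hq, hg, hvalid, hyx ▸ hy⟩

end Liveness

section Main

variable [SemilatticeSup X] {F : Finset (Fin n)} {x : Fin n → X}
  {E : Execution (protocol n f X) F x} {τ : ℕ → ℝ} {k : ℕ} {i : Fin n}

theorem exists_out (R : Run f F x (issued E)) (T : E.IsRoundTiming τ) (hi : i ∉ F) :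
    ∃ k, τ k ≤ (3 * (4 * depth f + 2) : ℕ) ∧ ∃ g V y, E.out k i = some y ∧
      g.length = depth f ∧ Valid f (total (issued E)) g V ∧ (i, x i) ∈ V ∧
      IsLUB (Prod.snd '' (V : Set (Fin n × X))) y := by
  obtain ⟨k, hk, g, V, hq, hg, hvalid, hmem⟩ := exists_leaf R T hi
  have hout : E.out k i = decision V := result_of_leaf hq hg
  have hsome : decision V = some (V.sup' ⟨_, hmem⟩ Prod.snd) := dif_pos _
  exact ⟨k, hk, g, V, _, hout.trans hsome, hg, hvalid, hmem, isLUB_of_decision_eq_some hsome⟩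

theorem agreement (hf : 3 * f < n) (hF : F.card ≤ f) (E : Execution (protocol n f X) F x) :
    ∃ y : Fin n → X, (∀ i ∉ F, E.Decides i (y i)) ∧ IsBLA F x y := by
  have R := run E hf hF
  obtain ⟨i₀, -, -, hi₀⟩ : ∃ i ∈ Finset.univ, i ∈ Finset.univ ∧ i ∉ F :=
    exists_correct_of_card hf hF (by simp) (by simp)
  have : Nonempty X := ⟨x i₀⟩
  have hex : ∀ i ∉ F, ∃ g V y, E.Decides i y ∧ g.length = depth f ∧
      Valid f (total (issued E)) g V ∧ (i, x i) ∈ V ∧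
      IsLUB (Prod.snd '' (V : Set (Fin n × X))) y := by
    intro i hi
    obtain ⟨k, -, g, V, y, hout, h⟩ := exists_out R E.isRoundTiming_zero hi
    exact ⟨g, V, y, E.decides_of_output_stable result_react hout, h⟩
  choose! g V y hdec hlen hvalid hmem hlub using hex
  refine ⟨y, hdec, isBLA_of_chain (C := R.finite_certifiedSet.toFinset) (V := V) ⟨i₀, hi₀⟩
    ?_ ?_ ?_ hmem ?_ hlub⟩
  · rw [Set.Finite.coe_toFinset]
    exact R.injOn_certifiedSet
  · exact fun e he => R.eq_input_of_mem_certifiedSet (R.finite_certifiedSet.mem_toFinset.1 he)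
  · exact fun i hi e he => R.finite_certifiedSet.mem_toFinset.2
      (R.coe_subset_certifiedSet (hvalid i hi) he)
  · exact fun i hi j hj => R.comparable (hlen i hi) (hlen j hj) (hvalid i hi) (hvalid j hj)

theorem answered_subset (E : Execution (protocol n f X) F x) (k : ℕ) (i : Fin n) :
    (stateAt E k i).answered ⊆ Finset.univ ×ˢ Finset.range (4 * depth f + 2) := by
  rintro ⟨j, p⟩ h
  obtain ⟨a, -, m, r, φ, hs, rfl⟩ := exists_signs_of_mem_answered h
  exact Finset.mem_product.2
    ⟨Finset.mem_univ _, Finset.mem_range.2 hs.canAnswer.grants.slot_lt⟩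

theorem budget_le (R : Run f F x (issued E)) (hi : i ∉ F) (k : ℕ) :
    budget n f (stateAt E k i) ≤ n * (8 * depth f + 7) := by
  have hans := Finset.card_le_card (answered_subset E k i)
  rw [Finset.card_product, Finset.card_univ, Fintype.card_fin, Finset.card_range] at hans
  have hquery := Nat.mul_le_mul_left n (query_supported R hi k).slot_lt
  calc budget n f (stateAt E k i) ≤ n * (4 * depth f + 2) + n * (4 * depth f + 5) :=
        Nat.add_le_add hans hquery
    _ = n * (8 * depth f + 7) := by ring

theorem length_sent_le (R : Run f F x (issued E)) (k : ℕ) :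
    (E.conf k).sent.length ≤ n * (n * (8 * depth f + 7)) := by
  calc (E.conf k).sent.length ≤ ∑ i ∈ Fᶜ, budget n f (stateAt E k i) :=
        E.length_sent_le_sum (fun _ st => budget n f st)
          (fun i y => by simp [length_broadcast, budget, initial, slot])
          (fun i st j m => length_react_add_budget_le f i st j m) k
    _ ≤ Fᶜ.card * (n * (8 * depth f + 7)) :=
        Finset.sum_le_card_nsmul _ _ _ fun i hi => budget_le R (Finset.mem_compl.1 hi) k
    _ ≤ n * (n * (8 * depth f + 7)) :=
        Nat.mul_le_mul_right _ ((Finset.card_le_univ _).trans_eq (Fintype.card_fin n))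

theorem solves (hf : 3 * f < n) : Solves (protocol n f X) f (3 * (4 * depth f + 2))
    (n * (n * (8 * depth f + 7))) where
  signsHonestly := signsHonestly n f
  agreement _ hF _ E := agreement hf hF E
  rounds _ hF _ E _ T _ hi := by
    obtain ⟨k, hk, -, -, y, hout, -⟩ := exists_out (run E hf hF) T hi
    exact ⟨k, hk, Option.isSome_of_eq_some hout⟩
  messages _ hF _ E k := length_sent_le (run E hf hF) k

end Main

end AuthBLA.Halving

theorem theorem2 :
    ∃ c : ℕ, ∀ (n f : ℕ), 3 * f < n → ∀ (X : Type*) [SemilatticeSup X],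
      ∃ P : AuthBLA.Protocol n X,
        AuthBLA.Solves P f (c * (Nat.log 2 f + 1)) (c * n ^ 2 * (Nat.log 2 f + 1)) := by
  refine ⟨18, fun n f hf X _ => ⟨AuthBLA.Halving.protocol n f X, ?_⟩⟩
  refine (AuthBLA.Halving.solves hf).mono ?_ ?_
  · unfold AuthBLA.Halving.depth
    omega
  · unfold AuthBLA.Halving.depth
    nlinarith [Nat.zero_le (n ^ 2 * Nat.log 2 f)]
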